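/- **Setting.** In each round $t=1,\dots,T$ a context $x_t\in\mathbb R^d$, $\|x_t\|\le B$, fixed in advance by an oblivious adversary, is revealed. The valuations are $s_t=\langle x_t,\theta^s\rangle+\xi^s_t$ (seller) and $b_t=\langle x_t,\theta^b\rangle+\xi^b_t$ (buyer), with unknown $\|\theta^s\|,\|\theta^b\|\le A$ and noise pairs $(\xi^s_t,\xi^b_t)$ that are i.i.d. over $t$ with an arbitrary law on $[-C,C]^2$ (zero noise allowed). Put $P=C+AB>0$, so valuations lie in $[-P,P]$. The learner posts $p_t$ to the seller and $q_t$ to the buyer; trade happens if $s_t\le p_t$ and $q_t\le b_t$, with gain from trade $b_t-s_t$ and profit $\mathrm{Prof}_t=q_t-p_t$ (both $0$ without trade). Let $G(x,p,q)$ be the expected gain from trade for context $x$. The (pseudo-)regret of round $t$ is $\max_{p\le q,\ p,q\in[-P,P]}G(x_t,p,q)-G(x_t,p_t,q_t)$. Two-bit feedback is $(\mathbb 1\{s_t\le p_t\},\mathbb 1\{q_t\le b_t\})$, one-bit feedback is the product of these bits. **Two-bit explore-or-commit algorithm.** A (randomized) algorithm $\mathcal A$ that in each round, based on its state and $x_t$,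 posts one price $p_t$ to both agents and declares the round either an exploration of the seller, or an exploration of the buyer, or a commit round; it updates its state with the bit $\mathbb 1\{s_t\le p_t\}$, respectively $\mathbb 1\{p_t\le b_t\}$, in an exploration round, and uses no feedback in a commit round. Let $T_E\ge1$ be an integer, and suppose that for every sequence of contexts of norm at most $B$, with probability at least $1-\delta$, $\mathcal A$ run for $T$ rounds with two-bit feedback has at most $T_E$ exploration rounds and total regret at most $R^{(2)}$ in its commit rounds. **One-bit algorithm.** Let $\alpha\in(0,1)$ and $\beta=\max\{2048P^4\alpha^{-2}\log^3T,\ 2PT_E\}$. (1) Until the cumulative profit reaches $\beta$, draw $p_t$ uniform in $[-P,P]$ and an integer $i_t$ uniform in $[0,\log_2T]$, and post $(p_t,p_t+2^{-i_t})$. (2) Then run $\mathcal A$: commit rounds are copied; when $\mathcal A$ explores the seller (the buyer) at price $p$, post $(p,-P)$ (respectively $(P,p)$) and give $\mathcal A$ the observed bit (a price $p>P$, respectively $p<-P$, being replaced by $P$, respectively $-P$). If the cumulative profit is below $2P$ when $\mathcal A$ wants to explore, stop the simulation for good and post arbitrary equal prices $p_t=q_t$ from then on. **Theorem.** Let $T\ge2$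 and assume the market is active: almost surely, $\sum_{t\le t'}(b_t-s_t)\ge\alpha t'$ for every integer $t'\in[\log T,T]$. Then the one-bit algorithm is globally budget balanced: $\sum_{t=1}^T\mathrm{Prof}_t(p_t,q_t)\ge0$ always. Moreover, there is a universal integer $k$, and for every integer $\gamma\ge0$ a constant $K$ depending only on $P,\alpha,\gamma$, such that with probability at least $1-\delta-T^{-\gamma}$ its regret over the $T$ rounds is at most $$K\,T_E\,(\log T)^k+R^{(2)}.$$ -/

import Mathlib

open MeasureTheory

/-! ## Bilateral trade: valuations, gain from trade, profit -/

/-- A linear market with noise: in a round with feature vector `x` and noise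
`ξ = (ξˢ, ξᵇ)` drawn from `noise`, the seller's valuation is `⟨x, θˢ⟩ + ξˢ` and the buyer's
valuation is `⟨x, θᵇ⟩ + ξᵇ`. The noiseless model is `noise = Measure.dirac 0`. -/
structure Market (d : ℕ) where
  sellerParam : EuclideanSpace ℝ (Fin d)
  buyerParam : EuclideanSpace ℝ (Fin d)
  noise : Measure (ℝ × ℝ)
  isProb : IsProbabilityMeasure noise

attribute [instance] Market.isProb

namespace Market

variable {d : ℕ}

/-- The seller's valuation. -/
noncomputable def sellerVal (M : Market d) (x : EuclideanSpace ℝ (Fin d)) (ξ : ℝ × ℝ) : ℝ :=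
  inner ℝ x M.sellerParam + ξ.1

/-- The buyer's valuation. -/
noncomputable def buyerVal (M : Market d) (x : EuclideanSpace ℝ (Fin d)) (ξ : ℝ × ℝ) : ℝ :=
  inner ℝ x M.buyerParam + ξ.2

end Market

/-- Gain from trade for valuations `s, b` and prices `p` (to the seller), `q` (to the buyer). -/
noncomputable def gainFromTrade (s b p q : ℝ) : ℝ :=
  if s ≤ p ∧ q ≤ b then b - s else 0

/-- Profit of the platform for valuations `s, b` and prices `p`, `q`. -/
noncomputable def profit (s b p q : ℝ) : ℝ :=
  if s ≤ p ∧ q ≤ b then q - p else 0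

/-- Two-bit feedback: each agent reveals whether they accept their price. -/
noncomputable def twoBitFeedback (s b p q : ℝ) : Bool × Bool :=
  (decide (s ≤ p), decide (q ≤ b))

/-- One-bit feedback: only whether the trade happened. -/
noncomputable def oneBitFeedback (s b p q : ℝ) : Bool :=
  decide (s ≤ p) && decide (q ≤ b)

namespace Market

variable {d : ℕ}

/-- Expected gain from trade of the prices `(p, q)` for the feature vector `x`. -/
noncomputable def egft (M : Market d) (x : EuclideanSpace ℝ (Fin d)) (p q : ℝ) : ℝ :=
  ∫ ξ, gainFromTrade (M.sellerVal x ξ) (M.buyerVal x ξ) p q ∂M.noise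

/-- Benchmark: the best expected gain from trade over `(p, q) ∈ [-P, P]²` with `p ≤ q`. -/
noncomputable def bestEgft (M : Market d) (P : ℝ) (x : EuclideanSpace ℝ (Fin d)) : ℝ :=
  sSup ((fun r : ℝ × ℝ => M.egft x r.1 r.2) ''
    {r | r.1 ∈ Set.Icc (-P) P ∧ r.2 ∈ Set.Icc (-P) P ∧ r.1 ≤ r.2})

/-- Active market with parameter `α` over the horizon `T`: almost surely, for every `t'` with
`log T ≤ t' ≤ T`, the sum of `b_t - s_t` over the first `t'` rounds is at least `α t'`. -/
def Active (M : Market d) (x : ℕ → EuclideanSpace ℝ (Fin d)) (α : ℝ) (T : ℕ) : Prop :=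
  ∀ᵐ ξ ∂(Measure.infinitePi fun _ : ℕ => M.noise),
    ∀ t' : ℕ, Real.log T ≤ (t' : ℝ) → t' ≤ T →
      α * t' ≤ ∑ t ∈ Finset.range t', (M.buyerVal (x t) (ξ t) - M.sellerVal (x t) (ξ t))

end Market

/-! ## Learners and their runs -/

/-- A randomized learner that sees a context in `X`, posts a pair of prices and then receives
feedback in `Z`. The seeds of the rounds are independent with law `seedLaw`. -/
structure Learner (X Z : Type) where
  State : Type
  Seed : Type
  [measurableSeed : MeasurableSpace Seed]
  seedLaw : Measure Seed
  isProb : IsProbabilityMeasure seedLaw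
  init : State
  /-- the price for the seller and the price for the buyer -/
  post : State → X → Seed → ℝ × ℝ
  update : State → X → Seed → Z → State

attribute [instance] Learner.measurableSeed Learner.isProb

namespace Learner

variable {d : ℕ} {Z : Type}

/-- Law of the noise and of the learner's seeds: everything is independent across rounds, and
seeds are independent of the noise. -/
noncomputable def pathLaw (L : Learner (EuclideanSpace ℝ (Fin d)) Z) (M : Market d) :
    Measure (ℕ → (ℝ × ℝ) × L.Seed) :=
  Measure.infinitePi fun _ : ℕ => M.noise.prod L.seedLaw

/-- State of the learner at the beginning of round `t` (rounds are numbered from `0`), under the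
feedback rule `fb s b p q`, along the sample path `ω`. -/
noncomputable def stateAt (L : Learner (EuclideanSpace ℝ (Fin d)) Z) (M : Market d)
    (fb : ℝ → ℝ → ℝ → ℝ → Z) (x : ℕ → EuclideanSpace ℝ (Fin d))
    (ω : ℕ → (ℝ × ℝ) × L.Seed) : ℕ → L.State
  | 0 => L.init
  | t + 1 =>
    let σ := L.stateAt M fb x ω t
    let r := L.post σ (x t) (ω t).2
    L.update σ (x t) (ω t).2
      (fb (M.sellerVal (x t) (ω t).1) (M.buyerVal (x t) (ω t).1) r.1 r.2)

/-- Prices posted in round `t`. -/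
noncomputable def pricesAt (L : Learner (EuclideanSpace ℝ (Fin d)) Z) (M : Market d)
    (fb : ℝ → ℝ → ℝ → ℝ → Z) (x : ℕ → EuclideanSpace ℝ (Fin d))
    (ω : ℕ → (ℝ × ℝ) × L.Seed) (t : ℕ) : ℝ × ℝ :=
  L.post (L.stateAt M fb x ω t) (x t) (ω t).2

/-- Pseudo-regret of the first `T` rounds. -/
noncomputable def regret (L : Learner (EuclideanSpace ℝ (Fin d)) Z) (M : Market d)
    (fb : ℝ → ℝ → ℝ → ℝ → Z) (P : ℝ) (x : ℕ → EuclideanSpace ℝ (Fin d)) (T : ℕ)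
    (ω : ℕ → (ℝ × ℝ) × L.Seed) : ℝ :=
  ∑ t ∈ Finset.range T, (M.bestEgft P (x t) -
    M.egft (x t) (L.pricesAt M fb x ω t).1 (L.pricesAt M fb x ω t).2)

/-- Total profit of the first `T` rounds. -/
noncomputable def totalProfit (L : Learner (EuclideanSpace ℝ (Fin d)) Z) (M : Market d)
    (fb : ℝ → ℝ → ℝ → ℝ → Z) (x : ℕ → EuclideanSpace ℝ (Fin d)) (T : ℕ)
    (ω : ℕ → (ℝ × ℝ) × L.Seed) : ℝ :=
  ∑ t ∈ Finset.range T,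
    profit (M.sellerVal (x t) (ω t).1) (M.buyerVal (x t) (ω t).1)
      (L.pricesAt M fb x ω t).1 (L.pricesAt M fb x ω t).2

end Learner

/-! ## Explore-or-commit algorithms for two-bit feedback -/

/-- The agent whose reaction is used in an exploration round. -/
inductive Side
  | seller
  | buyer

/-- What a round is used for. -/
inductive Decision
  | explore (a : Side)
  | commit

instance : MeasurableSpace Decision := ⊤

/-- An explore-or-commit algorithm. In each round it decides, from its state, the context and a
fresh random seed, either to explore or to commit, and chooses one price, posted to both agents.
After an exploration round it updates its state with the bit of the agent it explores; after a
commit round it makes no use of the feedback. (Exploring both agents takes two rounds.) -/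
structure ExploreOrCommit (X : Type) [MeasurableSpace X] where
  State : Type
  Seed : Type
  [measurableState : MeasurableSpace State]
  [measurableSeed : MeasurableSpace Seed]
  seedLaw : Measure Seed
  isProb : IsProbabilityMeasure seedLaw
  init : State
  decide : State → X → Seed → Decision
  price : State → X → Seed → ℝ
  learn : State → X → Seed → Bool → State
  advance : State → X → Seed → State
  measurable_decide : Measurable fun r : State × X × Seed => decide r.1 r.2.1 r.2.2
  measurable_price : Measurable fun r : State × X × Seed => price r.1 r.2.1 r.2.2
  measurable_learn :
    Measurable fun r : State × X × Seed × Bool => learn r.1 r.2.1 r.2.2.1 r.2.2.2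
  measurable_advance : Measurable fun r : State × X × Seed => advance r.1 r.2.1 r.2.2

attribute [instance] ExploreOrCommit.measurableState ExploreOrCommit.measurableSeed
  ExploreOrCommit.isProb

namespace ExploreOrCommit

/-- The algorithm as a learner with two-bit feedback; it posts the same price to both agents. -/
abbrev twoBit {X : Type} [MeasurableSpace X] (A : ExploreOrCommit X) : Learner X (Bool × Bool) where
  State := A.State
  Seed := A.Seed
  seedLaw := A.seedLaw
  isProb := A.isProb
  init := A.init
  post σ x u := (A.price σ x u, A.price σ x u)
  update σ x u z :=
    match A.decide σ x u with
    | Decision.explore Side.seller => A.learn σ x u z.1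
    | Decision.explore Side.buyer => A.learn σ x u z.2
    | Decision.commit => A.advance σ x u

variable {d : ℕ}

/-- Use of round `t` in the run of the algorithm with two-bit feedback. -/
noncomputable def decisionAt (A : ExploreOrCommit (EuclideanSpace ℝ (Fin d))) (M : Market d)
    (x : ℕ → EuclideanSpace ℝ (Fin d)) (ω : ℕ → (ℝ × ℝ) × A.twoBit.Seed) (t : ℕ) : Decision :=
  A.decide (A.twoBit.stateAt M twoBitFeedback x ω t) (x t) (ω t).2

/-- Number of exploration rounds among the first `T` rounds. -/
noncomputable def explorationRounds (A : ExploreOrCommit (EuclideanSpace ℝ (Fin d)))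
    (M : Market d) (x : ℕ → EuclideanSpace ℝ (Fin d)) (T : ℕ)
    (ω : ℕ → (ℝ × ℝ) × A.twoBit.Seed) : ℕ :=
  ∑ t ∈ Finset.range T,
    match A.decisionAt M x ω t with
    | Decision.explore _ => 1
    | Decision.commit => 0

/-- Pseudo-regret of the commit rounds among the first `T` rounds. -/
noncomputable def commitRegret (A : ExploreOrCommit (EuclideanSpace ℝ (Fin d)))
    (M : Market d) (P : ℝ) (x : ℕ → EuclideanSpace ℝ (Fin d)) (T : ℕ)
    (ω : ℕ → (ℝ × ℝ) × A.twoBit.Seed) : ℝ :=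
  ∑ t ∈ Finset.range T,
    match A.decisionAt M x ω t with
    | Decision.explore _ => 0
    | Decision.commit => M.bestEgft P (x t) -
        M.egft (x t) (A.twoBit.pricesAt M twoBitFeedback x ω t).1
          (A.twoBit.pricesAt M twoBitFeedback x ω t).2

/-- Guarantee in the market `M` against an oblivious adversary: for every sequence of contexts of
norm at most `B`, with probability at least `1 - δ` the run over `T` rounds has at most `TE`
exploration rounds and its commit rounds have regret at most `R`. -/
def Guarantee (A : ExploreOrCommit (EuclideanSpace ℝ (Fin d))) (M : Market d)
    (P B : ℝ) (T TE : ℕ) (R δ : ℝ) : Prop :=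
  ∀ y : ℕ → EuclideanSpace ℝ (Fin d), (∀ t, ‖y t‖ ≤ B) →
    1 - δ ≤ (A.twoBit.pathLaw M).real
      {ω | A.explorationRounds M y T ω ≤ TE ∧ A.commitRegret M P y T ω ≤ R}

end ExploreOrCommit

/-! ## The one-bit algorithm -/

/-- Phases of the one-bit algorithm. -/
inductive Phase
  | collect
  | simulate
  | halted

/-- The budget to be collected before the simulation starts. -/
noncomputable def targetBudget (P α : ℝ) (T TE : ℕ) : ℝ :=
  max (2048 * P ^ 4 * (α ^ 2)⁻¹ * Real.log T ^ 3) (2 * P * TE)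

namespace ExploreOrCommit

/-- State of the one-bit algorithm: phase, profit so far, state of the simulated algorithm. -/
structure OneBitState (S : Type) where
  phase : Phase
  wealth : ℝ
  inner : S

/-- Prices of the one-bit algorithm; `v`, `i` are the seeds of the budget collection and `u` is
the seed of the simulated algorithm.
* Collecting: `p` is uniform in `[-P, P]` if `v` is uniform in `[0, 1]`, and `q = p + 2⁻ⁱ`.
* Simulating: commit rounds are copied; a price `p` that explores the seller (the buyer) becomes
  the pair `(p, -P)` (the pair `(P, p)`), where a `p` beyond `P` (below `-P`) is replaced by `P`
  (by `-P`), as valuations are in `[-P, P]`. An exploration that the profit so far may not cover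
  is not carried out.
* Then, and when halted, the price `fallback` is posted to both agents. -/
noncomputable def oneBitPost {X : Type} [MeasurableSpace X] (A : ExploreOrCommit X) (P : ℝ)
    (fallback : A.State → X → A.Seed → ℝ) (σ : OneBitState A.State) (x : X)
    (v : ℝ) (i : ℕ) (u : A.Seed) : ℝ × ℝ :=
  match σ.phase with
  | Phase.collect => (P * (2 * v - 1), P * (2 * v - 1) + (2 : ℝ)⁻¹ ^ i)
  | Phase.simulate =>
    match A.decide σ.inner x u with
    | Decision.commit => (A.price σ.inner x u, A.price σ.inner x u)
    | Decision.explore Side.seller =>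
      if 2 * P ≤ σ.wealth then (min (A.price σ.inner x u) P, -P)
      else (fallback σ.inner x u, fallback σ.inner x u)
    | Decision.explore Side.buyer =>
      if 2 * P ≤ σ.wealth then (P, max (A.price σ.inner x u) (-P))
      else (fallback σ.inner x u, fallback σ.inner x u)
  | Phase.halted => (fallback σ.inner x u, fallback σ.inner x u)

/-- State update of the one-bit algorithm, where `r` are the prices it has just posted and `z`
tells whether the trade happened. Collecting ends as soon as the profit reaches `budget`; the
simulation ends for good at the first exploration that the profit so far may not cover. -/
noncomputable def oneBitUpdate {X : Type} [MeasurableSpace X] (A : ExploreOrCommit X)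
    (P budget : ℝ) (σ : OneBitState A.State) (x : X) (u : A.Seed) (r : ℝ × ℝ) (z : Bool) :
    OneBitState A.State :=
  let w : ℝ := σ.wealth + if z then r.2 - r.1 else 0
  match σ.phase with
  | Phase.collect => ⟨if budget ≤ w then Phase.simulate else Phase.collect, w, σ.inner⟩
  | Phase.simulate =>
    match A.decide σ.inner x u with
    | Decision.commit => ⟨Phase.simulate, w, A.advance σ.inner x u⟩
    | Decision.explore _ =>
      if 2 * P ≤ σ.wealth then ⟨Phase.simulate, w, A.learn σ.inner x u z⟩
      else ⟨Phase.halted, w, σ.inner⟩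
  | Phase.halted => ⟨Phase.halted, w, σ.inner⟩

/-- The one-bit algorithm for the horizon `T` built from `A`. In each round it draws independent
seeds: one uniform in `[0, 1]`, one uniform integer in `[0, log₂ T]`, and one for `A`. -/
noncomputable abbrev oneBit {X : Type} [MeasurableSpace X] (A : ExploreOrCommit X) (P budget : ℝ)
    (T : ℕ) (fallback : A.State → X → A.Seed → ℝ) : Learner X Bool where
  State := OneBitState A.State
  Seed := (unitInterval × Fin (Nat.log 2 T + 1)) × A.Seed
  seedLaw := ((volume : Measure unitInterval).prod
    (ProbabilityTheory.uniformOn (Set.univ : Set (Fin (Nat.log 2 T + 1))))).prod A.seedLaw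
  isProb := by
    have := ProbabilityTheory.isProbabilityMeasure_uniformOn
      (Set.finite_univ (α := Fin (Nat.log 2 T + 1))) Set.univ_nonempty
    infer_instance
  init := ⟨Phase.collect, 0, A.init⟩
  post σ x u := A.oneBitPost P fallback σ x u.1.1 u.1.2 u.2
  update σ x u z :=
    A.oneBitUpdate P budget σ x u.2 (A.oneBitPost P fallback σ x u.1.1 u.1.2 u.2) z

end ExploreOrCommit

/-! Budget balance is a pathwise invariant: the wealth never becomes negative. Collection rounds
post `p ≤ q`, an exploration loses at most `2P` and is carried out only with wealth at least `2P`,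
and all other rounds post equal prices (`wealth_add_profit_nonneg`).

For the regret, fix one grid step `h = 2⁻ⁱ < α`. A collection round draws this step together with a
price in `[s, b - h]` with probability at least `(b - s - h) / (2P (log₂ T + 1))`, and then earns
`h`. This bound is linear in `b - s`, so it can be averaged over the noise and summed over rounds,
and activity enters only through `∑ E[b_t - s_t] ≥ αN`. The expected profit of `N` rounds is thus at
least `cN / (log₂ T + 1)` with `c = h(α - h) / (2P)`. A Chernoff bound shows that some `N = O(TE
log⁴ T)` rounds reach the budget `β = O(TE log³ T)` except with probability `T^(-γ)`
(`measureReal_collected_le`).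

Collection ends at a stopping time `n`. The later noise and simulation seeds are independent of the
first `n` rounds, and the guarantee of `A` covers every context sequence, hence also the shifted
one; so the simulated run fails with probability at most `δ`
(`Guarantee.measureReal_simulation_failure_le`). While `A` explores at most `TE` times, `β ≥ 2P·TE`
pays for all explorations and the simulation moves in lockstep with the two-bit run
(`oneBit_simulation`). Collection and exploration rounds cost at most `4P` each, and commit rounds
cost at most `R` together. Horizons too short for this argument are covered by the trivial bound
`4PT`. -/

namespace Market

/-! ### Expected gain from trade: bounds and measurability. -/

variable {d : ℕ} {M : Market d} {P : ℝ} {x : EuclideanSpace ℝ (Fin d)}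

/-- For the context `x`, both valuations lie in `[-P, P]` almost surely. -/
def BoundedAt (M : Market d) (P : ℝ) (x : EuclideanSpace ℝ (Fin d)) : Prop :=
  ∀ᵐ ξ ∂M.noise, |M.sellerVal x ξ| ≤ P ∧ |M.buyerVal x ξ| ≤ P

@[fun_prop]
lemma measurable_sellerVal : Measurable (M.sellerVal x) := by
  unfold sellerVal; fun_prop

@[fun_prop]
lemma measurable_buyerVal : Measurable (M.buyerVal x) := by
  unfold buyerVal; fun_prop

lemma boundedAt_of_norm_le {a B C : ℝ} (hs : ‖M.sellerParam‖ ≤ a) (hb : ‖M.buyerParam‖ ≤ a)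
    (hx : ‖x‖ ≤ B) (hξ : ∀ᵐ ξ ∂M.noise, |ξ.1| ≤ C ∧ |ξ.2| ≤ C) :
    M.BoundedAt (C + a * B) x := by
  have key : ∀ θ : EuclideanSpace ℝ (Fin d), ‖θ‖ ≤ a → |inner ℝ x θ| ≤ a * B := fun θ hθ =>
    calc |inner ℝ x θ| ≤ ‖x‖ * ‖θ‖ := abs_real_inner_le_norm x θ
      _ ≤ B * a := mul_le_mul hx hθ (norm_nonneg _) ((norm_nonneg _).trans hx)
      _ = a * B := mul_comm _ _
  filter_upwards [hξ] with ξ h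
  constructor
  · exact (abs_add_le _ _).trans (by linarith [key _ hs, h.1])
  · exact (abs_add_le _ _).trans (by linarith [key _ hb, h.2])

lemma abs_egft_le (hP : 0 < P) (h : M.BoundedAt P x) (p q : ℝ) : |M.egft x p q| ≤ 2 * P := by
  have : ‖M.egft x p q‖ ≤ 2 * P * M.noise.real Set.univ := by
    refine norm_integral_le_of_norm_le_const ?_
    filter_upwards [h] with ξ hξ
    rw [Real.norm_eq_abs, gainFromTrade]
    split_ifs
    · exact (abs_sub _ _).trans (by linarith [hξ.1, hξ.2])
    · simp [hP.le]
  simpa using this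

lemma bestEgft_le (hP : 0 < P) (h : M.BoundedAt P x) : M.bestEgft P x ≤ 2 * P := by
  refine csSup_le ⟨_, (P, P), ⟨⟨by linarith, le_rfl⟩, ⟨by linarith, le_rfl⟩, le_rfl⟩, rfl⟩ ?_
  rintro _ ⟨r, -, rfl⟩
  exact (abs_le.1 (abs_egft_le hP h _ _)).2

lemma egft_self_le_bestEgft_of_mem (hP : 0 < P) (h : M.BoundedAt P x) {p : ℝ}
    (hp : p ∈ Set.Icc (-P) P) : M.egft x p p ≤ M.bestEgft P x := by
  refine le_csSup ⟨2 * P, ?_⟩ ⟨(p, p), ⟨hp, hp, le_rfl⟩, rfl⟩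
  rintro _ ⟨r, -, rfl⟩
  exact (abs_le.1 (abs_egft_le hP h _ _)).2

lemma bestEgft_nonneg (hP : 0 < P) (h : M.BoundedAt P x) : 0 ≤ M.bestEgft P x := by
  refine le_trans ?_ (egft_self_le_bestEgft_of_mem hP h (p := P) ⟨by linarith, le_rfl⟩)
  refine integral_nonneg fun ξ => ?_
  simp only [gainFromTrade, Pi.zero_apply]
  split_ifs with h1
  · linarith [h1.1, h1.2]
  · exact le_rfl

/-- Posting one price to both agents, even outside `[-P, P]`, does not beat the benchmark. -/
lemma egft_self_le_bestEgft (hP : 0 < P) (h : M.BoundedAt P x) (p : ℝ) :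
    M.egft x p p ≤ M.bestEgft P x := by
  by_cases hp : p ∈ Set.Icc (-P) P
  · exact egft_self_le_bestEgft_of_mem hP h hp
  refine le_trans (le_of_eq ?_) (bestEgft_nonneg hP h)
  -- A trade at a common price forces `-P ≤ s ≤ p ≤ b ≤ P`, so a price outside `[-P, P]` almost
  -- surely never trades.
  refine integral_eq_zero_of_ae ?_
  filter_upwards [h] with ξ hξ
  simp only [gainFromTrade, Pi.zero_apply, ite_eq_right_iff]
  rintro ⟨h1, h2⟩
  exact absurd ⟨(abs_le.1 hξ.1).1.trans h1, h2.trans (abs_le.1 hξ.2).2⟩ hp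

lemma bestEgft_sub_egft_le (hP : 0 < P) (h : M.BoundedAt P x) (p q : ℝ) :
    M.bestEgft P x - M.egft x p q ≤ 4 * P := by
  linarith [bestEgft_le hP h, (abs_le.1 (abs_egft_le hP h p q)).1]

@[fun_prop]
lemma measurable_egft : Measurable fun r : ℝ × ℝ => M.egft x r.1 r.2 := by
  have : Measurable fun z : (ℝ × ℝ) × (ℝ × ℝ) =>
      gainFromTrade (M.sellerVal x z.2) (M.buyerVal x z.2) z.1.1 z.1.2 := by
    unfold gainFromTrade
    have hs : Measurable fun z : (ℝ × ℝ) × (ℝ × ℝ) => M.sellerVal x z.2 := by fun_prop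
    have hb : Measurable fun z : (ℝ × ℝ) × (ℝ × ℝ) => M.buyerVal x z.2 := by fun_prop
    exact Measurable.ite ((measurableSet_le hs (by fun_prop)).inter
      (measurableSet_le (by fun_prop) hb)) (hb.sub hs) measurable_const
  exact (this.stronglyMeasurable.integral_prod_right' (ν := M.noise)).measurable

end Market

/-! ### Measurability and monotonicity for the two-bit run. -/

lemma measurable_decide_le {Ω : Type*} [MeasurableSpace Ω] {f g : Ω → ℝ} (hf : Measurable f)
    (hg : Measurable g) : Measurable fun ω => decide (f ω ≤ g ω) := by
  refine measurable_to_bool ?_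
  have : (fun ω => decide (f ω ≤ g ω)) ⁻¹' {true} = {ω | f ω ≤ g ω} := by ext; simp
  rw [this]
  exact measurableSet_le hf hg

instance : Countable Decision :=
  Function.Injective.countable (β := ℕ) (f := fun
    | Decision.explore Side.seller => 0
    | Decision.explore Side.buyer => 1
    | Decision.commit => 2) (by rintro ((_ | _) | _) ((_ | _) | _) h <;> simp_all)

lemma Decision.measurable_match {Ω β : Type*} [MeasurableSpace Ω] [MeasurableSpace β]
    {D : Ω → Decision} (hD : Measurable D) {f g h : Ω → β} (hf : Measurable f)
    (hg : Measurable g) (hh : Measurable h) :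
    Measurable fun ω => match D ω with
      | Decision.explore Side.seller => f ω
      | Decision.explore Side.buyer => g ω
      | Decision.commit => h ω := by
  have : Measurable fun r : Decision × β × β × β => match r.1 with
      | Decision.explore Side.seller => r.2.1
      | Decision.explore Side.buyer => r.2.2.1
      | Decision.commit => r.2.2.2 := by
    refine measurable_from_prod_countable_right fun D => ?_
    rcases D with (_ | _) | _ <;> fun_prop
  exact this.comp (hD.prodMk (hf.prodMk (hg.prodMk hh)))

lemma Decision.measurable_match_explore {Ω β : Type*} [MeasurableSpace Ω] [MeasurableSpace β]
    {D : Ω → Decision} (hD : Measurable D) {f g : Ω → β} (hf : Measurable f)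
    (hg : Measurable g) :
    Measurable fun ω => match D ω with
      | Decision.explore _ => f ω
      | Decision.commit => g ω := by
  convert Decision.measurable_match hD hf hf hg using 2 with ω
  rcases h : D ω with (_ | _) | _ <;> rfl

namespace ExploreOrCommit

variable {d : ℕ} (A : ExploreOrCommit (EuclideanSpace ℝ (Fin d))) (M : Market d)
  (y : ℕ → EuclideanSpace ℝ (Fin d))

lemma measurable_stateAt (t : ℕ) : Measurable[_, A.measurableState]
    fun ω : ℕ → (ℝ × ℝ) × A.Seed => A.twoBit.stateAt M twoBitFeedback y ω t := by
  induction t with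
  | zero => exact measurable_const
  | succ t ih =>
    have hu : Measurable fun ω : ℕ → (ℝ × ℝ) × A.Seed => (ω t).2 := by fun_prop
    have hs : Measurable fun ω : ℕ → (ℝ × ℝ) × A.Seed => M.sellerVal (y t) (ω t).1 := by fun_prop
    have hb : Measurable fun ω : ℕ → (ℝ × ℝ) × A.Seed => M.buyerVal (y t) (ω t).1 := by fun_prop
    have hr : Measurable fun ω : ℕ → (ℝ × ℝ) × A.Seed =>
        (A.twoBit.stateAt M twoBitFeedback y ω t, y t, (ω t).2) :=
      ih.prodMk (measurable_const.prodMk hu)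
    have hp := A.measurable_price.comp hr
    exact Decision.measurable_match (A.measurable_decide.comp hr)
      (A.measurable_learn.comp (ih.prodMk ((measurable_const (a := y t)).prodMk
        (hu.prodMk (measurable_decide_le hs hp)))))
      (A.measurable_learn.comp (ih.prodMk ((measurable_const (a := y t)).prodMk
        (hu.prodMk (measurable_decide_le hp hb)))))
      (A.measurable_advance.comp hr)

lemma measurable_stateAt_seed (t : ℕ) : Measurable fun ω : ℕ → (ℝ × ℝ) × A.Seed =>
    ((A.twoBit.stateAt M twoBitFeedback y ω t : A.State), y t, (ω t).2) :=
  (A.measurable_stateAt M y t).prodMk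
    (measurable_const.prodMk (measurable_snd.comp (measurable_pi_apply t)))

lemma measurable_decisionAt (t : ℕ) :
    Measurable fun ω : ℕ → (ℝ × ℝ) × A.Seed => A.decisionAt M y ω t :=
  A.measurable_decide.comp (A.measurable_stateAt_seed M y t)

lemma measurable_explorationRounds (T : ℕ) :
    Measurable fun ω : ℕ → (ℝ × ℝ) × A.Seed => A.explorationRounds M y T ω :=
  Finset.measurable_fun_sum _ fun t _ =>
    Decision.measurable_match_explore (A.measurable_decisionAt M y t)
      measurable_const measurable_const

lemma measurable_commitRegret (P : ℝ) (T : ℕ) :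
    Measurable fun ω : ℕ → (ℝ × ℝ) × A.Seed => A.commitRegret M P y T ω :=
  Finset.measurable_fun_sum _ fun t _ =>
    have hp : Measurable fun ω : ℕ → (ℝ × ℝ) × A.Seed =>
        (A.twoBit.pricesAt M twoBitFeedback y ω t) :=
      have := A.measurable_price.comp (A.measurable_stateAt_seed M y t)
      this.prodMk this
    Decision.measurable_match_explore (A.measurable_decisionAt M y t) measurable_const
      (measurable_const.sub (Market.measurable_egft.comp hp))

variable {A M y} {P : ℝ}

lemma explorationRounds_succ (n : ℕ) (ω : ℕ → (ℝ × ℝ) × A.Seed) :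
    A.explorationRounds M y (n + 1) ω = A.explorationRounds M y n ω +
      match A.decisionAt M y ω n with
      | Decision.explore _ => 1
      | Decision.commit => 0 :=
  Finset.sum_range_succ _ _

lemma explorationRounds_mono (ω : ℕ → (ℝ × ℝ) × A.Seed) :
    Monotone fun n => A.explorationRounds M y n ω :=
  monotone_nat_of_le_succ fun n => by
    rw [explorationRounds_succ]; exact Nat.le_add_right _ _

lemma commitRegret_succ (n : ℕ) (ω : ℕ → (ℝ × ℝ) × A.Seed) :
    A.commitRegret M P y (n + 1) ω = A.commitRegret M P y n ω +
      match A.decisionAt M y ω n with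
      | Decision.explore _ => 0
      | Decision.commit => M.bestEgft P (y n) -
          M.egft (y n) (A.twoBit.pricesAt M twoBitFeedback y ω n).1
            (A.twoBit.pricesAt M twoBitFeedback y ω n).2 :=
  Finset.sum_range_succ _ _

/-- Each commit round posts one price to both agents, so its regret is nonnegative. This lets a
guarantee over `T` rounds be used for a simulation that has fewer rounds left. -/
lemma commitRegret_mono (hP : 0 < P) (hy : ∀ t, M.BoundedAt P (y t))
    (ω : ℕ → (ℝ × ℝ) × A.Seed) : Monotone fun n => A.commitRegret M P y n ω :=
  monotone_nat_of_le_succ fun n => by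
    rw [commitRegret_succ]
    refine le_add_of_nonneg_right ?_
    split
    · exact le_rfl
    · exact sub_nonneg.2 (Market.egft_self_le_bestEgft hP (hy n) _)

lemma commitRegret_nonneg (hP : 0 < P) (hy : ∀ t, M.BoundedAt P (y t))
    (ω : ℕ → (ℝ × ℝ) × A.Seed) (n : ℕ) : 0 ≤ A.commitRegret M P y n ω :=
  (le_of_eq (by simp [commitRegret])).trans (commitRegret_mono hP hy ω n.zero_le)

end ExploreOrCommit

/-! ### Independence of past and future at a stopping time. -/

section Shift

open ProbabilityTheory

variable {Y Z : Type*} [MeasurableSpace Y] [MeasurableSpace Z]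

/-- The σ-algebra on sequences generated by the coordinates in `S`. -/
abbrev coordSigma (Y : Type*) [MeasurableSpace Y] (S : Set ℕ) : MeasurableSpace (ℕ → Y) :=
  ⨆ i ∈ S, MeasurableSpace.comap (fun ω : ℕ → Y => ω i) inferInstance

lemma measurable_coordSigma {S : Set ℕ} {i : ℕ} (hi : i ∈ S) :
    Measurable[coordSigma Y S] fun ω : ℕ → Y => ω i :=
  Measurable.of_comap_le (le_iSup₂_of_le i hi le_rfl)

lemma coordSigma_le (S : Set ℕ) : coordSigma Y S ≤ MeasurableSpace.pi :=
  iSup₂_le fun i _ => (measurable_pi_apply i).comap_le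

/-- Shifting an i.i.d. sequence and applying a map to every term gives an i.i.d. sequence. -/
lemma infinitePi_map_shift (μ : Measure Y) [IsProbabilityMeasure μ] {f : Y → Z}
    (hf : Measurable f) (n : ℕ) :
    (Measure.infinitePi fun _ : ℕ => μ).map (fun ω k => f (ω (n + k))) =
      Measure.infinitePi fun _ : ℕ => μ.map f := by
  have h1 := Measure.infinitePi_map_pi (fun _ : ℕ => μ) (f := fun _ => f) (fun _ => hf)
  have h2 := Measure.map_infinitePi_infinitePi_of_inj (P := fun _ : ℕ => μ)
    (add_right_injective n)
  rw [← h1]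
  conv_rhs => rw [← h2]
  rw [Measure.map_map (by fun_prop) (by fun_prop)]
  rfl

/-- `S` depends on the coordinates below `n` and the shifted sequence on those from `n` on; these
two blocks are independent. -/
lemma infinitePi_inter_preimage_shift (μ : Measure Y) [IsProbabilityMeasure μ] {f : Y → Z}
    (hf : Measurable f) (n : ℕ) {S : Set (ℕ → Y)}
    (hS : MeasurableSet[coordSigma Y (Set.Iio n)] S) {B : Set (ℕ → Z)} (hB : MeasurableSet B) :
    (Measure.infinitePi fun _ : ℕ => μ) (S ∩ (fun ω k => f (ω (n + k))) ⁻¹' B) =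
      (Measure.infinitePi fun _ : ℕ => μ) S * (Measure.infinitePi fun _ : ℕ => μ.map f) B := by
  have hind : iIndepFun (fun (i : ℕ) (ω : ℕ → Y) => ω i) (Measure.infinitePi fun _ : ℕ => μ) :=
    iIndepFun_infinitePi (P := fun _ : ℕ => μ) (X := fun _ => id) (fun _ => measurable_id)
  have h := indep_iSup_of_disjoint (fun i => (measurable_pi_apply i).comap_le) hind
    (S := Set.Iio n) (T := Set.Ici n)
    (Set.disjoint_left.2 fun i hi hi' => not_lt.2 (Set.mem_Ici.1 hi') (Set.mem_Iio.1 hi))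
  have hm : Measurable[coordSigma Y (Set.Ici n)] (fun (ω : ℕ → Y) (k : ℕ) => f (ω (n + k))) := by
    refine @measurable_pi_lambda _ _ _ (coordSigma Y (Set.Ici n)) _ _ fun k => ?_
    exact hf.comp (measurable_coordSigma (Set.mem_Ici.2 (Nat.le_add_right n k)))
  rw [(Indep_iff _ _ _).1 h S _ hS (hm hB), ← infinitePi_map_shift μ hf n,
    Measure.map_apply (by fun_prop) hB]

/-- If at a stopping time, on the event `S n` that it equals `n`, a bad event of probability at most
`ε` for the future has to be avoided, then this fails with probability at most `ε`. -/
lemma infinitePi_iUnion_inter_shift_le (μ : Measure Y) [IsProbabilityMeasure μ] {f : Y → Z}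
    (hf : Measurable f) {S : ℕ → Set (ℕ → Y)}
    (hS : ∀ n, MeasurableSet[coordSigma Y (Set.Iio n)] (S n))
    (hdisj : Pairwise (Function.onFun Disjoint S)) {B : ℕ → Set (ℕ → Z)}
    (hB : ∀ n, MeasurableSet (B n)) {ε : ENNReal}
    (hε : ∀ n, (Measure.infinitePi fun _ : ℕ => μ.map f) (B n) ≤ ε) :
    (Measure.infinitePi fun _ : ℕ => μ) (⋃ n, S n ∩ (fun ω k => f (ω (n + k))) ⁻¹' B n) ≤ ε :=
  calc _ ≤ ∑' n, (Measure.infinitePi fun _ : ℕ => μ)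
          (S n ∩ (fun ω k => f (ω (n + k))) ⁻¹' B n) := measure_iUnion_le _
    _ ≤ ∑' n, (Measure.infinitePi fun _ : ℕ => μ) (S n) * ε :=
        ENNReal.tsum_le_tsum fun n => by
          rw [infinitePi_inter_preimage_shift μ hf n (hS n) (hB n)]
          gcongr
          exact hε n
    -- Disjointness of the `S n` caps their total mass at 1, so the sum over stopping times costs no
    -- factor.
    _ = (Measure.infinitePi fun _ : ℕ => μ) (⋃ n, S n) * ε := by
        rw [ENNReal.tsum_mul_right, measure_iUnion hdisj fun n => coordSigma_le _ _ (hS n)]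
    _ ≤ 1 * ε := by gcongr; exact prob_le_one
    _ = ε := one_mul ε

end Shift

/-! ### A Chernoff bound for the lower tail. -/

lemma Real.exp_neg_le_one_sub_half {x : ℝ} (h0 : 0 ≤ x) (h1 : x ≤ 1) :
    Real.exp (-x) ≤ 1 - x / 2 := by
  rw [Real.exp_neg]
  calc (Real.exp x)⁻¹ ≤ (x + 1)⁻¹ := by
        gcongr
        exact Real.add_one_le_exp x
    _ ≤ 1 - x / 2 := by
        rw [inv_le_iff_one_le_mul₀ (by linarith)]
        nlinarith

section Chernoff

open ProbabilityTheory

/-- Lower-tail Chernoff bound for a sum of independent variables with values in `[0, 1]`. -/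
lemma ProbabilityTheory.iIndepFun.measureReal_sum_le_le_exp {Ω ι : Type*} [MeasurableSpace Ω]
    {μ : Measure Ω} [IsProbabilityMeasure μ] {X : ι → Ω → ℝ} (hind : iIndepFun X μ)
    (hX : ∀ i, Measurable (X i)) (h01 : ∀ i ω, X i ω ∈ Set.Icc (0 : ℝ) 1) (s : Finset ι) (b : ℝ) :
    μ.real {ω | ∑ i ∈ s, X i ω ≤ b} ≤ Real.exp (b - (∑ i ∈ s, ∫ ω, X i ω ∂μ) / 2) := by
  have hint : ∀ i, Integrable (X i) μ := fun i =>
    Integrable.of_bound (hX i).aestronglyMeasurable 1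
      (Filter.Eventually.of_forall fun ω => by
        rw [Real.norm_of_nonneg (h01 i ω).1]; exact (h01 i ω).2)
  -- At parameter `-1`: `E e^(-X) ≤ 1 - E X / 2 ≤ e^(-E X / 2)`.
  have hmgf : ∀ i, mgf (X i) μ (-1) ≤ Real.exp (-(∫ ω, X i ω ∂μ) / 2) := fun i =>
    calc mgf (X i) μ (-1) ≤ ∫ ω, (1 - X i ω / 2) ∂μ := by
          refine integral_mono_of_nonneg (Filter.Eventually.of_forall fun ω => by positivity)
            ((integrable_const _).sub ((hint i).div_const 2))
            (Filter.Eventually.of_forall fun ω => ?_)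
          simpa using Real.exp_neg_le_one_sub_half (h01 i ω).1 (h01 i ω).2
      _ = 1 - (∫ ω, X i ω ∂μ) / 2 := by
          rw [integral_sub (integrable_const _) ((hint i).div_const 2), integral_div]
          simp
      _ ≤ _ := by
          have := Real.add_one_le_exp (-(∫ ω, X i ω ∂μ) / 2)
          linarith
  have hsum : Integrable (fun ω => Real.exp (-1 * (∑ i ∈ s, X i) ω)) μ := by
    refine Integrable.of_bound (by fun_prop) 1 (Filter.Eventually.of_forall fun ω => ?_)
    rw [Real.norm_of_nonneg (Real.exp_pos _).le, Real.exp_le_one_iff, Finset.sum_apply]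
    have := Finset.sum_nonneg fun i (_ : i ∈ s) => (h01 i ω).1
    linarith
  calc μ.real {ω | ∑ i ∈ s, X i ω ≤ b}
      = μ.real {ω | (∑ i ∈ s, X i) ω ≤ b} := by simp
    _ ≤ Real.exp (-(-1) * b) * mgf (∑ i ∈ s, X i) μ (-1) :=
        measure_le_le_exp_mul_mgf b (by norm_num) hsum
    _ = Real.exp b * ∏ i ∈ s, mgf (X i) μ (-1) := by
        rw [hind.mgf_sum hX s]; simp
    _ ≤ Real.exp b * ∏ i ∈ s, Real.exp (-(∫ ω, X i ω ∂μ) / 2) := by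
        gcongr with i hi
        · exact fun i _ => mgf_nonneg
        · exact hmgf i
    _ = _ := by
        rw [← Real.exp_sum, ← Real.exp_add, ← Finset.sum_div, Finset.sum_neg_distrib]
        congr 1; ring

end Chernoff

/-! ### Profit of a single collection round. -/

lemma profit_nonneg {s b p q : ℝ} (h : p ≤ q) : 0 ≤ profit s b p q := by
  unfold profit; split_ifs <;> linarith

lemma profit_self (s b p : ℝ) : profit s b p p = 0 := by simp [profit]

/-- Law of the price seed and the grid seed of the budget collection. -/
noncomputable abbrev collectSeedLaw (L : ℕ) : Measure (unitInterval × Fin (L + 1)) :=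
  (volume : Measure unitInterval).prod
    (ProbabilityTheory.uniformOn (Set.univ : Set (Fin (L + 1))))

instance (L : ℕ) : IsProbabilityMeasure
    (ProbabilityTheory.uniformOn (Set.univ : Set (Fin (L + 1)))) :=
  ProbabilityTheory.isProbabilityMeasure_uniformOn
      (Set.finite_univ (α := Fin (L + 1))) Set.univ_nonempty

/-- Profit of a budget collection round with valuations `s`, `b`. -/
noncomputable def collectProfit {L : ℕ} (P s b : ℝ) (r : unitInterval × Fin (L + 1)) : ℝ :=
  profit s b (P * (2 * r.1 - 1)) (P * (2 * r.1 - 1) + (2 : ℝ)⁻¹ ^ (r.2 : ℕ))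

lemma collectProfit_mem {L : ℕ} (P s b : ℝ) (r : unitInterval × Fin (L + 1)) :
    collectProfit P s b r ∈ Set.Icc (0 : ℝ) 1 := by
  have h : (2 : ℝ)⁻¹ ^ (r.2 : ℕ) ≤ 1 := pow_le_one₀ (by norm_num) (by norm_num)
  refine ⟨profit_nonneg (by simp), ?_⟩
  simp only [collectProfit, profit]
  split_ifs
  · linarith
  · exact zero_le_one

lemma measurable_collectProfit {L : ℕ} {Ω : Type*} [MeasurableSpace Ω] {P : ℝ} {s b : Ω → ℝ}
    {r : Ω → unitInterval × Fin (L + 1)} (hs : Measurable s) (hb : Measurable b)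
    (hr : Measurable r) : Measurable fun ω => collectProfit P (s ω) (b ω) (r ω) := by
  have hi : Measurable fun ω => (2 : ℝ)⁻¹ ^ ((r ω).2 : ℕ) :=
    (measurable_of_finite fun i : Fin (L + 1) => (2 : ℝ)⁻¹ ^ (i : ℕ)).comp hr.snd
  have hv : Measurable fun ω => P * (2 * ((r ω).1 : ℝ) - 1) := by
    have : Measurable fun ω => ((r ω).1 : ℝ) := measurable_subtype_coe.comp hr.fst
    fun_prop
  unfold collectProfit profit
  exact Measurable.ite ((measurableSet_le hs hv).inter (measurableSet_le (hv.add hi) hb))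
    ((hv.add hi).sub hv) measurable_const

/-- Expected profit of a budget collection round: the grid step `2⁻ⁱ` alone contributes a profit
that is linear in `b - s`. -/
lemma le_integral_collectProfit {L i : ℕ} (hi : i ≤ L) {P s b : ℝ} (hP : 0 < P) (hs : |s| ≤ P)
    (hb : |b| ≤ P) :
    (2 : ℝ)⁻¹ ^ i * (b - s - (2 : ℝ)⁻¹ ^ i) / (2 * P * (L + 1)) ≤
      ∫ r, collectProfit P s b r ∂(collectSeedLaw L) := by
  set h : ℝ := (2 : ℝ)⁻¹ ^ i with hh
  have h0 : 0 < h := by positivity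
  -- For `b - s ≤ h` the bound is nonpositive, hence trivial; leaving it untruncated keeps it linear
  -- in `b - s`.
  rcases le_or_gt (b - s - h) 0 with hneg | hpos
  · refine le_trans ?_ (integral_nonneg fun r => (collectProfit_mem P s b r).1)
    exact div_nonpos_of_nonpos_of_nonneg (mul_nonpos_of_nonneg_of_nonpos h0.le hneg) (by positivity)
  obtain ⟨hs1, hs2⟩ := abs_le.1 hs
  obtain ⟨hb1, hb2⟩ := abs_le.1 hb
  -- `lo` and `hi'` are the preimages of the prices `s` and `b - h` under `v ↦ P(2v - 1)`. On `E`
  -- the step is `h` and both agents accept, so the profit is exactly `h`.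
  let lo : unitInterval := ⟨(s / P + 1) / 2, by
    constructor
    · have := (le_div_iff₀ hP).2 (show -1 * P ≤ s by linarith); linarith
    · have := (div_le_iff₀ hP).2 (show s ≤ 1 * P by linarith); linarith⟩
  let hi' : unitInterval := ⟨((b - h) / P + 1) / 2, by
    constructor
    · have := (le_div_iff₀ hP).2 (show -1 * P ≤ b - h by linarith); linarith
    · have := (div_le_iff₀ hP).2 (show b - h ≤ 1 * P by linarith); linarith⟩
  let E : Set (unitInterval × Fin (L + 1)) := Set.Icc lo hi' ×ˢ {⟨i, by omega⟩}
  have hE : MeasurableSet E := measurableSet_Icc.prod (measurableSet_singleton _)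
  have hvol : (collectSeedLaw L).real E = (b - s - h) / (2 * P * (L + 1)) := by
    rw [measureReal_prod_prod, measureReal_def, measureReal_def, unitInterval.volume_Icc,
      ProbabilityTheory.uniformOn_univ]
    have e : ((L : ENNReal) + 1).toReal = L + 1 := by
      rw [ENNReal.toReal_add (ENNReal.natCast_ne_top L) ENNReal.one_ne_top]; simp
    rw [ENNReal.toReal_ofReal]
    · simp [lo, hi', e]
      field_simp
      ring
    · simp [lo, hi']
      gcongr
      linarith
  calc h * (b - s - h) / (2 * P * (L + 1))
      = ∫ r, E.indicator (fun _ => h) r ∂(collectSeedLaw L) := by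
        rw [integral_indicator_const _ hE, hvol, smul_eq_mul]; ring
    _ ≤ _ := by
        refine integral_mono_of_nonneg
          (Filter.Eventually.of_forall fun r => Set.indicator_nonneg (fun _ _ => h0.le) r)
          (Integrable.of_bound (measurable_collectProfit measurable_const measurable_const
            measurable_id).aestronglyMeasurable 1 (Filter.Eventually.of_forall fun r => ?_))
          (Filter.Eventually.of_forall fun r => ?_)
        · rw [Real.norm_of_nonneg (collectProfit_mem P s b r).1]
          exact (collectProfit_mem P s b r).2
        · by_cases hr : r ∈ E
          · rw [Set.indicator_of_mem hr]
            obtain ⟨⟨hr1, hr2⟩, hr3⟩ := hr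
            have hr3 : (r.2 : ℕ) = i := by rw [Set.mem_singleton_iff.1 hr3]
            have hr1 : (s / P + 1) / 2 ≤ (r.1 : ℝ) := hr1
            have hr2 : (r.1 : ℝ) ≤ ((b - h) / P + 1) / 2 := hr2
            have e1 : s ≤ P * (2 * r.1 - 1) := by
              have := (div_le_iff₀ hP).1 (show s / P ≤ 2 * r.1 - 1 by linarith)
              linarith
            have e2 : P * (2 * r.1 - 1) + h ≤ b := by
              have := (le_div_iff₀ hP).1 (show 2 * (r.1 : ℝ) - 1 ≤ (b - h) / P by linarith)
              linarith
            simp [collectProfit, profit, hr3, ← hh, e1, e2]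
          · rw [Set.indicator_of_notMem hr]
            exact (collectProfit_mem P s b r).1

lemma integral_infinitePi_eval {Y : Type*} [MeasurableSpace Y] (μ : Measure Y)
    [IsProbabilityMeasure μ] {f : Y → ℝ} (hf : Measurable f) (t : ℕ) :
    ∫ ω, f (ω t) ∂(Measure.infinitePi fun _ : ℕ => μ) = ∫ y, f y ∂μ := by
  have hmp := measurePreserving_eval_infinitePi (fun _ : ℕ => μ) t
  have := integral_map hmp.measurable.aemeasurable hf.aestronglyMeasurable
    (μ := Measure.infinitePi fun _ : ℕ => μ)
  rw [hmp.map_eq] at this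
  exact this.symm

/-! ### Speed of the budget collection in an active market. -/

namespace Market

variable {d : ℕ} {M : Market d} {P : ℝ} {x : ℕ → EuclideanSpace ℝ (Fin d)}

lemma integrable_buyerVal_sub_sellerVal {z : EuclideanSpace ℝ (Fin d)} (h : M.BoundedAt P z) :
    Integrable (fun ξ => M.buyerVal z ξ - M.sellerVal z ξ) M.noise := by
  refine Integrable.of_bound (by fun_prop) (P + P) ?_
  filter_upwards [h] with ξ hξ
  exact (abs_sub _ _).trans (add_le_add hξ.2 hξ.1)

/-- An active market is active in expectation. -/
lemma Active.le_sum_integral {α : ℝ} {T N : ℕ} (hact : M.Active x α T)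
    (hb : ∀ t, M.BoundedAt P (x t)) (hN : Real.log T ≤ N) (hNT : N ≤ T) :
    α * N ≤ ∑ t ∈ Finset.range N, ∫ ξ, (M.buyerVal (x t) ξ - M.sellerVal (x t) ξ) ∂M.noise := by
  have hmp := fun t => measurePreserving_eval_infinitePi (fun _ : ℕ => M.noise) t
  have hint : ∀ t, Integrable (fun ξ : ℕ → ℝ × ℝ =>
      M.buyerVal (x t) (ξ t) - M.sellerVal (x t) (ξ t))
      (Measure.infinitePi fun _ : ℕ => M.noise) := fun t =>
    (hmp t).integrable_comp_of_integrable (integrable_buyerVal_sub_sellerVal (hb t))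
  calc α * N = ∫ _, α * N ∂(Measure.infinitePi fun _ : ℕ => M.noise) := by simp
    _ ≤ ∫ ξ, ∑ t ∈ Finset.range N, (M.buyerVal (x t) (ξ t) - M.sellerVal (x t) (ξ t))
          ∂(Measure.infinitePi fun _ : ℕ => M.noise) := by
        refine integral_mono_ae (integrable_const _) (integrable_finsetSum _ fun t _ => hint t) ?_
        filter_upwards [hact] with ξ hξ using hξ N hN hNT
    _ = _ := by
        rw [integral_finsetSum _ fun t _ => hint t]
        refine Finset.sum_congr rfl fun t _ => ?_
        exact integral_infinitePi_eval M.noise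
          (Market.measurable_buyerVal.sub Market.measurable_sellerVal) t

section Collect

variable {L : ℕ} {W : Type}

/-- Profit of the first `n` rounds if the budget collection goes on all the time. -/
noncomputable def collected (M : Market d) (P : ℝ) (x : ℕ → EuclideanSpace ℝ (Fin d)) (n : ℕ)
    (ω : ℕ → (ℝ × ℝ) × ((unitInterval × Fin (L + 1)) × W)) : ℝ :=
  ∑ t ∈ Finset.range n,
    collectProfit P (M.sellerVal (x t) (ω t).1) (M.buyerVal (x t) (ω t).1) (ω t).2.1

lemma collected_succ (n : ℕ) (ω : ℕ → (ℝ × ℝ) × ((unitInterval × Fin (L + 1)) × W)) :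
    M.collected P x (n + 1) ω = M.collected P x n ω +
      collectProfit P (M.sellerVal (x n) (ω n).1) (M.buyerVal (x n) (ω n).1) (ω n).2.1 :=
  Finset.sum_range_succ _ _

/-- The budget collection reaches the budget for the first time after `n` rounds. -/
def collectsAt (M : Market d) (P budget : ℝ) (x : ℕ → EuclideanSpace ℝ (Fin d)) (n : ℕ) :
    Set (ℕ → (ℝ × ℝ) × ((unitInterval × Fin (L + 1)) × W)) :=
  {ω | (∀ m < n, M.collected P x m ω < budget) ∧ budget ≤ M.collected P x n ω}

lemma pairwise_disjoint_collectsAt (budget : ℝ) :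
    Pairwise (Function.onFun Disjoint (M.collectsAt (L := L) (W := W) P budget x)) := by
  intro m n hmn
  refine Set.disjoint_left.2 fun ω hm hn => ?_
  rcases lt_or_gt_of_ne hmn with h | h
  · exact absurd hm.2 (not_le.2 (hn.1 m h))
  · exact absurd hn.2 (not_le.2 (hm.1 n h))

lemma exists_collectsAt {budget : ℝ} {N : ℕ}
    {ω : ℕ → (ℝ × ℝ) × ((unitInterval × Fin (L + 1)) × W)}
    (h : budget ≤ M.collected P x N ω) : ∃ n ≤ N, ω ∈ M.collectsAt P budget x n := by
  classical
  have hex : ∃ n, budget ≤ M.collected P x n ω := ⟨N, h⟩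
  exact ⟨Nat.find hex, Nat.find_min' hex h, fun m hm => not_le.1 (Nat.find_min hex hm),
    Nat.find_spec hex⟩

variable [MeasurableSpace W]

lemma measurable_collectProfit_round (z : EuclideanSpace ℝ (Fin d)) :
    Measurable fun r : (ℝ × ℝ) × ((unitInterval × Fin (L + 1)) × W) =>
      collectProfit P (M.sellerVal z r.1) (M.buyerVal z r.1) r.2.1 :=
  measurable_collectProfit (by fun_prop) (by fun_prop) (by fun_prop)

lemma measurable_collected {n N : ℕ} (hn : n ≤ N) :
    Measurable[coordSigma ((ℝ × ℝ) × ((unitInterval × Fin (L + 1)) × W)) (Set.Iio N)]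
      (M.collected P x n) := by
  refine Finset.measurable_fun_sum _ fun t ht => ?_
  exact (measurable_collectProfit_round (x t)).comp
    (measurable_coordSigma (Set.mem_Iio.2 ((Finset.mem_range.1 ht).trans_le hn)))

lemma le_integral_collectProfit_round {ν : Measure W} [IsProbabilityMeasure ν] {i : ℕ}
    (hi : i ≤ L) (hP : 0 < P) {z : EuclideanSpace ℝ (Fin d)} (hz : M.BoundedAt P z) :
    (2 : ℝ)⁻¹ ^ i * ((∫ ξ, (M.buyerVal z ξ - M.sellerVal z ξ) ∂M.noise) - (2 : ℝ)⁻¹ ^ i) /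
        (2 * P * (L + 1)) ≤
      ∫ r, collectProfit P (M.sellerVal z r.1) (M.buyerVal z r.1) r.2.1
        ∂(M.noise.prod ((collectSeedLaw L).prod ν)) := by
  have hint : Integrable (fun r : (ℝ × ℝ) × ((unitInterval × Fin (L + 1)) × W) =>
      collectProfit P (M.sellerVal z r.1) (M.buyerVal z r.1) r.2.1)
      (M.noise.prod ((collectSeedLaw L).prod ν)) :=
    Integrable.of_bound (measurable_collectProfit_round z).aestronglyMeasurable 1
      (Filter.Eventually.of_forall fun r => by
        rw [Real.norm_of_nonneg (collectProfit_mem _ _ _ _).1]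
        exact (collectProfit_mem _ _ _ _).2)
  have hg := integrable_buyerVal_sub_sellerVal hz
  rw [integral_prod _ hint]
  calc _ = ∫ ξ, (2 : ℝ)⁻¹ ^ i * (M.buyerVal z ξ - M.sellerVal z ξ - (2 : ℝ)⁻¹ ^ i) /
        (2 * P * (L + 1)) ∂M.noise := by
        rw [integral_div, integral_const_mul, integral_sub hg (integrable_const _)]
        simp
    _ ≤ _ := by
        refine integral_mono_ae (((hg.sub (integrable_const _)).const_mul _).div_const _)
          hint.integral_prod_left ?_
        filter_upwards [hz] with ξ hξ
        refine (le_integral_collectProfit hi hP hξ.1 hξ.2).trans (le_of_eq ?_)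
        rw [integral_fun_fst (μ := collectSeedLaw L) (ν := ν)
          (f := fun r => collectProfit P (M.sellerVal z ξ) (M.buyerVal z ξ) r)]
        simp

/-- In an active market, the budget collection is slow with exponentially small probability. -/
lemma measureReal_collected_le {ν : Measure W} [IsProbabilityMeasure ν] {i : ℕ} (hi : i ≤ L)
    (hP : 0 < P) (hb : ∀ t, M.BoundedAt P (x t)) {α : ℝ} {T N : ℕ} (hact : M.Active x α T)
    (hN : Real.log T ≤ N) (hNT : N ≤ T) (b : ℝ) :
    (Measure.infinitePi fun _ : ℕ => M.noise.prod ((collectSeedLaw L).prod ν)).real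
        {ω | M.collected P x N ω ≤ b} ≤
      Real.exp (b - N * ((2 : ℝ)⁻¹ ^ i * (α - (2 : ℝ)⁻¹ ^ i) / (2 * P * (L + 1))) / 2) := by
  set μ := M.noise.prod ((collectSeedLaw L).prod ν) with hμ
  let X : ℕ → (ℝ × ℝ) × ((unitInterval × Fin (L + 1)) × W) → ℝ := fun t r =>
    collectProfit P (M.sellerVal (x t) r.1) (M.buyerVal (x t) r.1) r.2.1
  have hX : ∀ t, Measurable (X t) := fun t => measurable_collectProfit_round (x t)
  have hind := ProbabilityTheory.iIndepFun_infinitePi (P := fun _ : ℕ => μ) hX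
  refine (hind.measureReal_sum_le_le_exp (fun t => (hX t).comp (measurable_pi_apply t))
    (fun t ω => collectProfit_mem _ _ _ _) (Finset.range N) b).trans ?_
  have hE := fun t => integral_infinitePi_eval μ (hX t) t
  rw [Real.exp_le_exp]
  gcongr
  simp_rw [hE]
  -- Activity bounds only the sum of the expected `b - s`; single rounds may have a negative one, so
  -- the rounds are compared in total.
  calc N * ((2 : ℝ)⁻¹ ^ i * (α - (2 : ℝ)⁻¹ ^ i) / (2 * P * (L + 1)))
      = (2 : ℝ)⁻¹ ^ i * (α * N - N * (2 : ℝ)⁻¹ ^ i) / (2 * P * (L + 1)) := by ring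
    _ ≤ (2 : ℝ)⁻¹ ^ i * ((∑ t ∈ Finset.range N,
          ∫ ξ, (M.buyerVal (x t) ξ - M.sellerVal (x t) ξ) ∂M.noise) - N * (2 : ℝ)⁻¹ ^ i) /
          (2 * P * (L + 1)) := by
        gcongr
        exact hact.le_sum_integral hb hN hNT
    _ = ∑ t ∈ Finset.range N, (2 : ℝ)⁻¹ ^ i *
          ((∫ ξ, (M.buyerVal (x t) ξ - M.sellerVal (x t) ξ) ∂M.noise) - (2 : ℝ)⁻¹ ^ i) /
          (2 * P * (L + 1)) := by
        rw [← Finset.sum_div, ← Finset.mul_sum, Finset.sum_sub_distrib]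
        simp
    _ ≤ _ := Finset.sum_le_sum fun t _ => le_integral_collectProfit_round hi hP (hb t)

/-- The end of collection is a stopping time: whether it occurs after `n` rounds is decided by the
rounds below `n`. -/
lemma measurableSet_collectsAt (budget : ℝ) (n : ℕ) :
    MeasurableSet[coordSigma ((ℝ × ℝ) × ((unitInterval × Fin (L + 1)) × W)) (Set.Iio n)]
      (M.collectsAt P budget x n) := by
  have h : M.collectsAt P budget x n =
      (⋂ m, ⋂ (_ : m < n), M.collected (L := L) (W := W) P x m ⁻¹' Set.Iio budget) ∩
        M.collected P x n ⁻¹' Set.Ici budget := by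
    ext ω; simp [collectsAt]
  rw [h]
  exact MeasurableSet.inter (MeasurableSet.iInter fun m => MeasurableSet.iInter fun hm =>
    measurable_collected hm.le measurableSet_Iio) (measurable_collected le_rfl measurableSet_Ici)

end Collect

end Market

/-! ### The one-bit algorithm along a fixed sample path. -/

lemma ite_oneBitFeedback (s b p q : ℝ) :
    (if oneBitFeedback s b p q then q - p else 0) = profit s b p q := by
  simp [oneBitFeedback, profit]

namespace ExploreOrCommit

section Update

variable {X : Type} [MeasurableSpace X] {A : ExploreOrCommit X} {P : ℝ}

lemma oneBitUpdate_wealth (budget : ℝ) (σ : OneBitState A.State) (x : X) (u : A.Seed)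
    (r : ℝ × ℝ) (z : Bool) : (A.oneBitUpdate P budget σ x u r z).wealth =
      σ.wealth + if z then r.2 - r.1 else 0 := by
  unfold oneBitUpdate
  generalize (if z then r.2 - r.1 else 0) = c
  dsimp only
  split
  · rfl
  · split
    · rfl
    · split_ifs <;> rfl
  · rfl

lemma oneBitUpdate_collect (budget : ℝ) (fallback : A.State → X → A.Seed → ℝ) (w : ℝ)
    (ι : A.State) (x : X) (v : ℝ) (i : ℕ) (u : A.Seed) (s b : ℝ) :
    let r := A.oneBitPost P fallback ⟨Phase.collect, w, ι⟩ x v i u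
    let w' := w + profit s b (P * (2 * v - 1)) (P * (2 * v - 1) + (2 : ℝ)⁻¹ ^ i)
    A.oneBitUpdate P budget ⟨Phase.collect, w, ι⟩ x u r (oneBitFeedback s b r.1 r.2) =
      ⟨if budget ≤ w' then Phase.simulate else Phase.collect, w', ι⟩ := by
  simp only [← ite_oneBitFeedback]
  rfl

/-- A round of the one-bit algorithm loses no more than the profit so far. -/
lemma wealth_add_profit_nonneg (fallback : A.State → X → A.Seed → ℝ)
    (σ : OneBitState A.State) (hσ : 0 ≤ σ.wealth) (x : X) (v : ℝ) (i : ℕ) (u : A.Seed) (s b : ℝ) :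
    0 ≤ σ.wealth + profit s b (A.oneBitPost P fallback σ x v i u).1
      (A.oneBitPost P fallback σ x v i u).2 := by
  unfold oneBitPost
  split
  · exact add_nonneg hσ (profit_nonneg (by simp))
  · split
    · simpa [profit_self] using hσ
    · split_ifs with h
      · unfold profit
        split_ifs
        -- Capping the price at `P` limits the loss to `2P`, which the wealth covers.
        · have := min_le_right (A.price σ.inner x u) P
          dsimp only
          linarith
        · simpa using hσ
      · simpa [profit_self] using hσ
    · split_ifs with h
      · unfold profit
        split_ifs
        · have := le_max_right (A.price σ.inner x u) (-P)
          dsimp only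
          linarith
        · simpa using hσ
      · simpa [profit_self] using hσ
  · simpa [profit_self] using hσ

end Update

variable {d : ℕ} {A : ExploreOrCommit (EuclideanSpace ℝ (Fin d))} {M : Market d} {P budget : ℝ}
  {T : ℕ} {fallback : A.State → EuclideanSpace ℝ (Fin d) → A.Seed → ℝ}
  {x : ℕ → EuclideanSpace ℝ (Fin d)}
  {ω : ℕ → (ℝ × ℝ) × ((unitInterval × Fin (Nat.log 2 T + 1)) × A.Seed)}

lemma oneBit_wealth_succ (n : ℕ) :
    ((A.oneBit P budget T fallback).stateAt M oneBitFeedback x ω (n + 1)).wealth =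
      ((A.oneBit P budget T fallback).stateAt M oneBitFeedback x ω n).wealth +
      profit (M.sellerVal (x n) (ω n).1) (M.buyerVal (x n) (ω n).1)
        ((A.oneBit P budget T fallback).pricesAt M oneBitFeedback x ω n).1
        ((A.oneBit P budget T fallback).pricesAt M oneBitFeedback x ω n).2 := by
  rw [← ite_oneBitFeedback]
  exact oneBitUpdate_wealth _ _ _ _ _ _

lemma oneBit_wealth_nonneg (n : ℕ) :
    0 ≤ ((A.oneBit P budget T fallback).stateAt M oneBitFeedback x ω n).wealth := by
  induction n with
  | zero => exact le_rfl
  | succ n ih =>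
    rw [oneBit_wealth_succ]
    exact wealth_add_profit_nonneg fallback _ ih _ _ _ _ _ _

lemma oneBit_totalProfit_eq_wealth (n : ℕ) :
    (A.oneBit P budget T fallback).totalProfit M oneBitFeedback x n ω =
      ((A.oneBit P budget T fallback).stateAt M oneBitFeedback x ω n).wealth := by
  induction n with
  | zero => rfl
  | succ n ih =>
    rw [oneBit_wealth_succ, ← ih]
    exact Finset.sum_range_succ _ _

/-- The one-bit algorithm is globally budget balanced on every sample path. -/
lemma oneBit_totalProfit_nonneg (n : ℕ) :
    0 ≤ (A.oneBit P budget T fallback).totalProfit M oneBitFeedback x n ω := by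
  rw [oneBit_totalProfit_eq_wealth]
  exact oneBit_wealth_nonneg n

lemma oneBit_stateAt_collect {n : ℕ} (h : ∀ m ≤ n, M.collected P x m ω < budget) :
    (A.oneBit P budget T fallback).stateAt M oneBitFeedback x ω n =
      ⟨Phase.collect, M.collected P x n ω, A.init⟩ := by
  induction n with
  | zero => rfl
  | succ n ih =>
    have ih := ih fun m hm => h m (hm.trans n.le_succ)
    have hn := h (n + 1) le_rfl
    rw [Market.collected_succ] at hn ⊢
    rw [Learner.stateAt, ih]
    refine (oneBitUpdate_collect _ _ _ _ _ _ _ _ _ _).trans ?_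
    exact congrArg (fun p => (⟨p, _, A.init⟩ : OneBitState A.State)) (if_neg (not_le.2 hn))

lemma oneBit_stateAt_collectsAt (hbudget : 0 < budget) {n : ℕ}
    (h : ω ∈ M.collectsAt P budget x n) :
    (A.oneBit P budget T fallback).stateAt M oneBitFeedback x ω n =
      ⟨Phase.simulate, M.collected P x n ω, A.init⟩ := by
  obtain ⟨h1, h2⟩ := h
  cases n with
  -- The budget is tested only after a round, so a collection of length 0 would break the claim;
  -- positivity of the budget excludes it.
  | zero => exact absurd h2 (not_le.2 hbudget)
  | succ n =>
    rw [Market.collected_succ] at h2 ⊢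
    rw [Learner.stateAt, oneBit_stateAt_collect fun m hm => h1 m (Nat.lt_succ_of_le hm)]
    refine (oneBitUpdate_collect _ _ _ _ _ _ _ _ _ _).trans ?_
    exact congrArg (fun p => (⟨p, _, A.init⟩ : OneBitState A.State)) (if_pos h2)

/-- The part of a sample path that the simulated algorithm uses if it is started in round `n`. -/
def simPath {V W : Type} (n : ℕ) (ω : ℕ → (ℝ × ℝ) × (V × W)) (k : ℕ) : (ℝ × ℝ) × W :=
  ((ω (n + k)).1, (ω (n + k)).2.2)

/-- The buyer always accepts `-P`, so the product bit is the seller's bit; capping `p` at `P ≥ s`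
does not change it. Exploring the buyer is symmetric. -/
lemma oneBitFeedback_explore_seller {s b p : ℝ} (hs : |s| ≤ P) (hb : |b| ≤ P) :
    oneBitFeedback s b (min p P) (-P) = (twoBitFeedback s b p p).1 := by
  simp [oneBitFeedback, twoBitFeedback, (abs_le.1 hs).2, (abs_le.1 hb).1]

lemma oneBitFeedback_explore_buyer {s b p : ℝ} (hs : |s| ≤ P) (hb : |b| ≤ P) :
    oneBitFeedback s b P (max p (-P)) = (twoBitFeedback s b p p).2 := by
  simp [oneBitFeedback, twoBitFeedback, (abs_le.1 hs).2, (abs_le.1 hb).1]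

/-- While the simulated algorithm explores at most `TE` times, the simulation goes on. -/
lemma oneBit_simulation (hP : 0 < P)
    (hω : ∀ t, |M.sellerVal (x t) (ω t).1| ≤ P ∧ |M.buyerVal (x t) (ω t).1| ≤ P) {n TE K : ℕ}
    {w : ℝ} (hw : 2 * P * TE ≤ w)
    (hn : (A.oneBit P budget T fallback).stateAt M oneBitFeedback x ω n =
      ⟨Phase.simulate, w, A.init⟩)
    (hTE : A.explorationRounds M (fun k => x (n + k)) K (simPath n ω) ≤ TE) {k : ℕ} (hk : k ≤ K) :
    ∃ w', 2 * P * (TE - A.explorationRounds M (fun k => x (n + k)) k (simPath n ω)) ≤ w' ∧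
      (A.oneBit P budget T fallback).stateAt M oneBitFeedback x ω (n + k) =
        ⟨Phase.simulate, w',
          A.twoBit.stateAt M twoBitFeedback (fun k => x (n + k)) (simPath n ω) k⟩ := by
  -- Invariant: the wealth still covers a loss of `2P` for each of the explorations left out of
  -- `TE`.
  induction k with
  | zero => exact ⟨w, by simpa [explorationRounds] using hw, hn⟩
  | succ k ih =>
    obtain ⟨w', hw', hst⟩ := ih (k.le_succ.trans hk)
    have hE := (explorationRounds_mono (A := A) (M := M) (y := fun k => x (n + k))
      (simPath n ω) hk).trans hTE
    have hsucc := explorationRounds_succ (A := A) (M := M) (y := fun k => x (n + k)) k (simPath n ω)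
    dsimp only at hE
    obtain ⟨hs, hb⟩ := hω (n + k)
    rw [hsucc] at hE ⊢
    rw [← add_assoc, Learner.stateAt, hst, Learner.stateAt]
    set σ := A.twoBit.stateAt M twoBitFeedback (fun k => x (n + k)) (simPath n ω) k with hσ
    have hD : A.decisionAt M (fun k => x (n + k)) (simPath n ω) k =
      A.decide σ (x (n + k)) (ω (n + k)).2.2 := rfl
    have hu : (simPath n ω k).2 = (ω (n + k)).2.2 := rfl
    have hξ : (simPath n ω k).1 = (ω (n + k)).1 := rfl
    rw [hD] at hE ⊢
    have hloss : ∀ p q : ℝ, -(2 * P) ≤ q - p → -(2 * P) ≤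
        profit (M.sellerVal (x (n + k)) (ω (n + k)).1) (M.buyerVal (x (n + k)) (ω (n + k)).1)
          p q := fun p q h => by
      unfold profit
      split_ifs
      · exact h
      · linarith
    simp only [oneBitPost, oneBitUpdate, ite_oneBitFeedback, hu, hξ]
    rcases hdec : A.decide σ (x (n + k)) (ω (n + k)).2.2 with (_ | _) | _
    all_goals simp only [hdec] at hE ⊢
    -- `hE` already counts the present exploration, so before it at least one was left and the
    -- simulation is not halted.
    · have h2P : 2 * P ≤ w' := by
        have : (1 : ℝ) ≤ TE - A.explorationRounds M (fun k => x (n + k)) k (simPath n ω) := by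
          have : (_ : ℝ) ≤ _ := Nat.cast_le.2 hE
          push_cast at this
          linarith
        nlinarith
      simp only [if_pos h2P, oneBitFeedback_explore_seller hs hb]
      refine ⟨_, ?_, rfl⟩
      have := hloss (min (A.price σ (x (n + k)) (ω (n + k)).2.2) P) (-P)
        (by linarith [min_le_right (A.price σ (x (n + k)) (ω (n + k)).2.2) P])
      push_cast
      linarith
    · have h2P : 2 * P ≤ w' := by
        have : (1 : ℝ) ≤ TE - A.explorationRounds M (fun k => x (n + k)) k (simPath n ω) := by
          have : (_ : ℝ) ≤ _ := Nat.cast_le.2 hE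
          push_cast at this
          linarith
        nlinarith
      simp only [if_pos h2P, oneBitFeedback_explore_buyer hs hb]
      refine ⟨_, ?_, rfl⟩
      have := hloss P (max (A.price σ (x (n + k)) (ω (n + k)).2.2) (-P))
        (by linarith [le_max_right (A.price σ (x (n + k)) (ω (n + k)).2.2) (-P)])
      push_cast
      linarith
    · simp only [profit_self, add_zero]
      exact ⟨w', hw', rfl⟩

/-- Regret of the simulation: the commit rounds have the regret of the simulated algorithm. -/
lemma oneBit_simulation_regret_le (hP : 0 < P) (hx : ∀ t, M.BoundedAt P (x t))
    (hω : ∀ t, |M.sellerVal (x t) (ω t).1| ≤ P ∧ |M.buyerVal (x t) (ω t).1| ≤ P) {n TE K : ℕ}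
    {w : ℝ} (hw : 2 * P * TE ≤ w)
    (hn : (A.oneBit P budget T fallback).stateAt M oneBitFeedback x ω n =
      ⟨Phase.simulate, w, A.init⟩)
    (hTE : A.explorationRounds M (fun k => x (n + k)) K (simPath n ω) ≤ TE) {k : ℕ} (hk : k ≤ K) :
    ∑ j ∈ Finset.range k, (M.bestEgft P (x (n + j)) - M.egft (x (n + j))
        ((A.oneBit P budget T fallback).pricesAt M oneBitFeedback x ω (n + j)).1
        ((A.oneBit P budget T fallback).pricesAt M oneBitFeedback x ω (n + j)).2) ≤
      A.commitRegret M P (fun k => x (n + k)) k (simPath n ω) +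
        4 * P * A.explorationRounds M (fun k => x (n + k)) k (simPath n ω) := by
  induction k with
  | zero => simp [commitRegret, explorationRounds]
  | succ k ih =>
    have ih := ih (k.le_succ.trans hk)
    obtain ⟨w', -, hst⟩ := oneBit_simulation hP hω hw hn hTE (k.le_succ.trans hk)
    rw [Finset.sum_range_succ, commitRegret_succ, explorationRounds_succ]
    rcases hdec : A.decisionAt M (fun k => x (n + k)) (simPath n ω) k with a | _
    · have := Market.bestEgft_sub_egft_le hP (hx (n + k))
        ((A.oneBit P budget T fallback).pricesAt M oneBitFeedback x ω (n + k)).1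
        ((A.oneBit P budget T fallback).pricesAt M oneBitFeedback x ω (n + k)).2
      push_cast
      linarith
    · have hp : (A.oneBit P budget T fallback).pricesAt M oneBitFeedback x ω (n + k) =
          A.twoBit.pricesAt M twoBitFeedback (fun k => x (n + k)) (simPath n ω) k := by
        rw [Learner.pricesAt, hst]
        simp only [oneBitPost]
        have hdec' : A.decide (A.twoBit.stateAt M twoBitFeedback (fun k => x (n + k))
          (simPath n ω) k) (x (n + k)) (ω (n + k)).2.2 = Decision.commit := hdec
        rw [hdec']
        rfl
      rw [hp]
      push_cast
      linarith

/-- Regret on a sample path on which the budget is collected in `n` rounds and the simulated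
algorithm keeps its guarantee. -/
lemma oneBit_regret_le (hP : 0 < P) (hx : ∀ t, M.BoundedAt P (x t))
    (hω : ∀ t, |M.sellerVal (x t) (ω t).1| ≤ P ∧ |M.buyerVal (x t) (ω t).1| ≤ P) {n TE : ℕ}
    (hbudget : 0 < budget) (hTEbudget : 2 * P * TE ≤ budget)
    (hn : ω ∈ M.collectsAt P budget x n) (hnT : n ≤ T) {R : ℝ}
    (hTE : A.explorationRounds M (fun k => x (n + k)) T (simPath n ω) ≤ TE)
    (hR : A.commitRegret M P (fun k => x (n + k)) T (simPath n ω) ≤ R) :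
    (A.oneBit P budget T fallback).regret M oneBitFeedback P x T ω ≤ 4 * P * (n + TE) + R := by
  -- Only `K = T - n` rounds are simulated, while the guarantee concerns `T`; monotonicity of both
  -- counters bridges this.
  obtain ⟨K, rfl⟩ := Nat.exists_eq_add_of_le hnT
  rw [Learner.regret, Finset.sum_range_add]
  have h1 := Finset.sum_le_card_nsmul (Finset.range n) _ (4 * P) fun t _ =>
    Market.bestEgft_sub_egft_le hP (hx t)
      ((A.oneBit P budget (n + K) fallback).pricesAt M oneBitFeedback x ω t).1
      ((A.oneBit P budget (n + K) fallback).pricesAt M oneBitFeedback x ω t).2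
  have h2 := oneBit_simulation_regret_le hP hx hω (hTEbudget.trans hn.2)
    (oneBit_stateAt_collectsAt (A := A) (fallback := fallback) hbudget hn) hTE
    (Nat.le_add_left K n)
  have h3 := commitRegret_mono (A := A) hP (fun k => hx (n + k)) (simPath n ω)
    (Nat.le_add_left K n)
  have h4 : (A.explorationRounds M (fun k => x (n + k)) K (simPath n ω) : ℝ) ≤ TE :=
    Nat.cast_le.2 ((explorationRounds_mono (A := A) (M := M) (simPath n ω)
      (Nat.le_add_left K n)).trans hTE)
  have h5 := mul_le_mul_of_nonneg_left h4 (show 0 ≤ 4 * P by linarith)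
  simp only [Finset.card_range, nsmul_eq_mul] at h1
  dsimp only at h3
  linarith

end ExploreOrCommit

/-! ### High-probability regret bounds. -/

namespace ExploreOrCommit

variable {d : ℕ} {A : ExploreOrCommit (EuclideanSpace ℝ (Fin d))} {M : Market d}
  {P B R δ budget : ℝ} {T TE : ℕ}
  {fallback : A.State → EuclideanSpace ℝ (Fin d) → A.Seed → ℝ}
  {x : ℕ → EuclideanSpace ℝ (Fin d)}

/-- Sample paths of the two-bit algorithm on which its guarantee fails. -/
def failure (A : ExploreOrCommit (EuclideanSpace ℝ (Fin d))) (M : Market d) (P : ℝ)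
    (y : ℕ → EuclideanSpace ℝ (Fin d)) (T TE : ℕ) (R : ℝ) : Set (ℕ → (ℝ × ℝ) × A.Seed) :=
  {ω | A.explorationRounds M y T ω ≤ TE ∧ A.commitRegret M P y T ω ≤ R}ᶜ

lemma measurableSet_failure (y : ℕ → EuclideanSpace ℝ (Fin d)) :
    MeasurableSet (A.failure M P y T TE R) :=
  ((measurableSet_le (A.measurable_explorationRounds M y T) measurable_const).inter
    (measurableSet_le (A.measurable_commitRegret M y P T) measurable_const)).compl

lemma Guarantee.measureReal_failure_le (hA : A.Guarantee M P B T TE R δ)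
    {y : ℕ → EuclideanSpace ℝ (Fin d)} (hy : ∀ t, ‖y t‖ ≤ B) :
    (Measure.infinitePi fun _ : ℕ => M.noise.prod A.seedLaw).real (A.failure M P y T TE R) ≤ δ := by
  have h := hA y hy
  have hm := (measurableSet_failure (A := A) (M := M) (P := P) (T := T) (TE := TE) (R := R) y).compl
  rw [failure, compl_compl] at hm
  have h2 := probReal_compl_eq_one_sub
    (μ := Measure.infinitePi fun _ : ℕ => M.noise.prod A.seedLaw) hm
  rw [failure, h2]
  change 1 - δ ≤ (Measure.infinitePi fun _ : ℕ => M.noise.prod A.seedLaw).real _ at h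
  linarith

/-- Commit regret is never negative, so with `R < 0` the guarantee always fails. This makes adding
`R` harmless in the bound for short horizons. -/
lemma Guarantee.nonneg_or_le (hA : A.Guarantee M P B T TE R δ) (hP : 0 < P)
    (hxB : ∀ t, ‖x t‖ ≤ B) (hx : ∀ t, M.BoundedAt P (x t)) : 0 ≤ R ∨ 1 ≤ δ := by
  by_contra! hcon
  have h := hA.measureReal_failure_le hxB
  have hu : A.failure M P x T TE R = Set.univ := by
    refine Set.eq_univ_of_forall fun ω hω => ?_
    linarith [hω.2, commitRegret_nonneg hP hx ω T]
  rw [hu, probReal_univ] at h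
  linarith [hcon.2]

lemma map_simulationSeed {V W : Type*} [MeasurableSpace V] [MeasurableSpace W]
    (μ : Measure (ℝ × ℝ)) [IsProbabilityMeasure μ] (κ : Measure V) [IsProbabilityMeasure κ]
    (ν : Measure W) [IsProbabilityMeasure ν] :
    (μ.prod (κ.prod ν)).map (fun r => (r.1, r.2.2)) = μ.prod ν := by
  have h := Measure.map_prod_map μ (κ.prod ν) measurable_id measurable_snd
  rw [Measure.map_id, Measure.map_snd_prod, measure_univ, one_smul] at h
  exact h.symm

/-- The simulated run that starts when the budget is reached fails with probability at most `δ`. -/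
lemma Guarantee.measureReal_simulation_failure_le (hA : A.Guarantee M P B T TE R δ)
    (hxB : ∀ t, ‖x t‖ ≤ B) {L : ℕ} :
    (Measure.infinitePi fun _ : ℕ => M.noise.prod ((collectSeedLaw L).prod A.seedLaw)).real
      (⋃ n, M.collectsAt P budget x n ∩
        simPath n ⁻¹' A.failure M P (fun k => x (n + k)) T TE R) ≤ δ := by
  have hδ : 0 ≤ δ := measureReal_nonneg.trans (hA.measureReal_failure_le hxB)
  refine ENNReal.toReal_le_of_le_ofReal hδ ?_
  refine infinitePi_iUnion_inter_shift_le (M.noise.prod ((collectSeedLaw L).prod A.seedLaw))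
    (f := fun r => (r.1, r.2.2)) (by fun_prop) (Market.measurableSet_collectsAt budget)
    (Market.pairwise_disjoint_collectsAt budget)
    (fun n => measurableSet_failure (fun k => x (n + k))) fun n => ?_
  rw [map_simulationSeed]
  -- The contexts are fixed in advance, so for each `n` the guarantee applies to the sequence
  -- shifted by `n`.
  exact (ENNReal.le_ofReal_iff_toReal_le (measure_ne_top _ _) hδ).2
    (hA.measureReal_failure_le fun k => hxB (n + k))

/-- High-probability regret bound of the one-bit algorithm if `N` rounds suffice to collect the
budget. -/
lemma Guarantee.le_measureReal_oneBit_regret_le (hA : A.Guarantee M P B T TE R δ) (hP : 0 < P)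
    (hxB : ∀ t, ‖x t‖ ≤ B) (hx : ∀ t, M.BoundedAt P (x t)) {α : ℝ} (hact : M.Active x α T)
    (hbudget : 0 < budget) (hTEbudget : 2 * P * TE ≤ budget) {N i : ℕ} (hi : i ≤ Nat.log 2 T)
    (hN : Real.log T ≤ N) (hNT : N ≤ T) {ε : ℝ}
    (hε : Real.exp (budget - N * ((2 : ℝ)⁻¹ ^ i * (α - (2 : ℝ)⁻¹ ^ i) /
      (2 * P * ((Nat.log 2 T : ℕ) + 1))) / 2) ≤ ε) :
    1 - δ - ε ≤ ((A.oneBit P budget T fallback).pathLaw M).real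
      {ω | (A.oneBit P budget T fallback).regret M oneBitFeedback P x T ω ≤
        4 * P * (N + TE) + R} := by
  set L := Nat.log 2 T
  set μ := Measure.infinitePi fun _ : ℕ => M.noise.prod ((collectSeedLaw L).prod A.seedLaw) with hμ
  have h1 := (Market.measureReal_collected_le (ν := A.seedLaw) hi hP hx hact hN hNT budget).trans hε
  have h2 := hA.measureReal_simulation_failure_le (budget := budget) hxB (L := L)
  rw [← hμ] at h1 h2
  set Slow := {ω : ℕ → (ℝ × ℝ) × ((unitInterval × Fin (L + 1)) × A.Seed) |
    M.collected P x N ω ≤ budget}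
  set Fail := ⋃ n, M.collectsAt (L := L) (W := A.Seed) P budget x n ∩
        simPath n ⁻¹' A.failure M P (fun k => x (n + k)) T TE R
  set Good := {ω | (A.oneBit P budget T fallback).regret M oneBitFeedback P x T ω ≤
        4 * P * (N + TE) + R}
  change 1 - δ - ε ≤ μ.real Good
  have hbdd : ∀ᵐ ω ∂μ, ∀ t, |M.sellerVal (x t) (ω t).1| ≤ P ∧ |M.buyerVal (x t) (ω t).1| ≤ P := by
    refine ae_all_iff.2 fun t => ?_
    have hmp := (measurePreserving_fst (μ := M.noise)
      (ν := (collectSeedLaw L).prod A.seedLaw)).comp (measurePreserving_eval_infinitePi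
        (fun _ : ℕ => M.noise.prod ((collectSeedLaw L).prod A.seedLaw)) t)
    exact hmp.quasiMeasurePreserving.ae (hx t)
  -- With an arbitrary `fallback`, `Good` need not be measurable; covering the space and using
  -- subadditivity avoids complements.
  have hcover : (Set.univ : Set _) ≤ᵐ[μ] (Good ∪ (Slow ∪ Fail) : Set _) := by
    filter_upwards [hbdd] with ω hω _
    by_contra hnot
    have hG : ω ∉ Good := fun h => hnot (Or.inl h)
    have hS : ω ∉ Slow := fun h => hnot (Or.inr (Or.inl h))
    have hF : ω ∉ Fail := fun h => hnot (Or.inr (Or.inr h))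
    obtain ⟨n, hnN, hn⟩ := Market.exists_collectsAt (not_le.1 hS).le
    have hok : ¬ simPath n ω ∈ A.failure M P (fun k => x (n + k)) T TE R := fun h =>
      hF (Set.mem_iUnion.2 ⟨n, hn, h⟩)
    obtain ⟨hE, hR⟩ := not_not.1 hok
    refine hG ((oneBit_regret_le hP hx hω hbudget hTEbudget hn (hnN.trans hNT) hE hR).trans ?_)
    gcongr
  have h3 : μ.real Set.univ ≤ μ.real (Good ∪ (Slow ∪ Fail)) :=
    ENNReal.toReal_mono (measure_ne_top _ _) (measure_mono_ae hcover)
  rw [probReal_univ] at h3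
  have h4 := measureReal_union_le (μ := μ) Good (Slow ∪ Fail)
  have h5 := measureReal_union_le (μ := μ) Slow Fail
  linarith

/-- Deterministic bound on the regret, used when the horizon is short. -/
lemma Guarantee.le_measureReal_oneBit_regret_le_of_short (hA : A.Guarantee M P B T TE R δ)
    (hP : 0 < P) (hxB : ∀ t, ‖x t‖ ≤ B) (hx : ∀ t, M.BoundedAt P (x t)) {ε D : ℝ} (hε : 0 ≤ ε)
    (hT : 4 * P * T ≤ D) :
    1 - δ - ε ≤ ((A.oneBit P budget T fallback).pathLaw M).real
      {ω | (A.oneBit P budget T fallback).regret M oneBitFeedback P x T ω ≤ D + R} := by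
  rcases hA.nonneg_or_le hP hxB hx with hR | hδ
  · have hu : {ω | (A.oneBit P budget T fallback).regret M oneBitFeedback P x T ω ≤ D + R} =
        Set.univ := by
      refine Set.eq_univ_of_forall fun ω => ?_
      have h1 := Finset.sum_le_card_nsmul (Finset.range T) _ (4 * P) fun t _ =>
        Market.bestEgft_sub_egft_le hP (hx t)
          ((A.oneBit P budget T fallback).pricesAt M oneBitFeedback x ω t).1
          ((A.oneBit P budget T fallback).pricesAt M oneBitFeedback x ω t).2
      simp only [Finset.card_range, nsmul_eq_mul] at h1
      rw [Set.mem_ofPred_eq, Learner.regret]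
      linarith
    have hδ : 0 ≤ δ := measureReal_nonneg.trans (hA.measureReal_failure_le hxB)
    have : IsProbabilityMeasure ((A.oneBit P budget T fallback).pathLaw M) := by
      unfold Learner.pathLaw; infer_instance
    rw [hu, probReal_univ]
    linarith
  · exact le_trans (by linarith) measureReal_nonneg

end ExploreOrCommit

/-! ### Numerical estimates. -/

lemma half_le_log_natCast {T : ℕ} (hT : 2 ≤ T) : 1 / 2 ≤ Real.log T := by
  have h2 : (2 : ℝ) ≤ T := by exact_mod_cast hT
  linarith [Real.log_two_gt_d9, Real.log_le_log (by norm_num) h2]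

lemma natLog_two_add_one_le {T : ℕ} (hT : 2 ≤ T) : (Nat.log 2 T : ℝ) + 1 ≤ 4 * Real.log T := by
  have h1 : ((2 ^ Nat.log 2 T : ℕ) : ℝ) ≤ T := Nat.cast_le.2 (Nat.pow_log_le_self 2 (by omega))
  have h2 := Real.log_le_log (by positivity) h1
  push_cast at h2
  rw [Real.log_pow] at h2
  have h3 : (0 : ℝ) ≤ Nat.log 2 T := Nat.cast_nonneg _
  nlinarith [Real.log_two_gt_d9, half_le_log_natCast hT]

lemma targetBudget_pos {P α : ℝ} (hP : 0 < P) (hα : 0 < α) {T : ℕ} (hT : 2 ≤ T) (TE : ℕ) :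
    0 < targetBudget P α T TE := by
  have := half_le_log_natCast hT
  exact lt_max_of_lt_left (by positivity)

/-- Number of rounds that suffice to collect the target budget, up to a factor that depends only
on `P`, `α`, `γ` and the expected profit `c / (log₂ T + 1)` of a round. -/
lemma ceil_collect_rounds_le {P α c : ℝ} (γ : ℕ) (hP : 0 < P) (hα : 0 < α) (hc : 0 < c) {T TE : ℕ}
    (hT : 2 ≤ T) (hTE : 1 ≤ TE) :
    (⌈2 * ((Nat.log 2 T : ℝ) + 1) / c * (targetBudget P α T TE + γ * Real.log T) +
      Real.log T⌉₊ : ℝ) ≤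
      (8 / c * (2048 * P ^ 4 * (α ^ 2)⁻¹ + 16 * P + 4 * γ) + 24) * (TE * Real.log T ^ 4) := by
  have hβ0 := targetBudget_pos hP hα hT TE
  have hℓ := half_le_log_natCast hT
  have hL := natLog_two_add_one_le hT
  have hTE' : (1 : ℝ) ≤ TE := by exact_mod_cast hTE
  have hγ : (0 : ℝ) ≤ γ := Nat.cast_nonneg γ
  set ℓ := Real.log T with hℓdef
  set β := targetBudget P α T TE
  set c₁ := 2048 * P ^ 4 * (α ^ 2)⁻¹ with hc₁
  have hc₁0 : 0 ≤ c₁ := by positivity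
  -- Powers of `1 ≤ 2ℓ` raise every lower-order term to `TE ℓ⁴`. The constant 24 is 8 for the
  -- summand `ℓ` plus 16 for rounding up.
  have e1 : 1 ≤ 2 * ℓ := by linarith
  have e2 : 1 ≤ 4 * ℓ ^ 2 := by nlinarith
  have e3 : 1 ≤ 8 * ℓ ^ 3 := by nlinarith
  have e4 : 1 ≤ 16 * ℓ ^ 4 := by nlinarith
  have hℓ0 : 0 < ℓ := by linarith
  have hβ : β ≤ TE * ℓ ^ 3 * (c₁ + 16 * P) := by
    refine max_le ?_ ?_
    · have : 0 ≤ ℓ ^ 3 * c₁ := by positivity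
      have : 0 ≤ TE * ℓ ^ 3 * (16 * P) := by positivity
      nlinarith
    · have : 0 ≤ TE * ℓ ^ 3 * c₁ := by positivity
      have := mul_le_mul_of_nonneg_left e3 (show 0 ≤ 2 * P * TE by positivity)
      nlinarith
  have hγℓ : γ * ℓ ≤ TE * ℓ ^ 3 * (4 * γ) := by
    calc γ * ℓ = 1 * 1 * (γ * ℓ) := by ring
      _ ≤ TE * (4 * ℓ ^ 2) * (γ * ℓ) := by gcongr
      _ = _ := by ring
  have h1 : 2 * ((Nat.log 2 T : ℝ) + 1) / c * (β + γ * ℓ) ≤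
      8 / c * (c₁ + 16 * P + 4 * γ) * (TE * ℓ ^ 4) := by
    calc 2 * ((Nat.log 2 T : ℝ) + 1) / c * (β + γ * ℓ)
        ≤ 2 * (4 * ℓ) / c * (TE * ℓ ^ 3 * (c₁ + 16 * P) + TE * ℓ ^ 3 * (4 * γ)) := by gcongr
      _ = _ := by ring
  have h2 : ℓ ≤ 8 * (TE * ℓ ^ 4) := by
    calc ℓ = 1 * 1 * ℓ := by ring
      _ ≤ TE * (8 * ℓ ^ 3) * ℓ := by gcongr
      _ = _ := by ring
  have h3 : 1 ≤ 16 * (TE * ℓ ^ 4) := by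
    calc (1 : ℝ) = 1 * 1 := by ring
      _ ≤ TE * (16 * ℓ ^ 4) := by gcongr
      _ = _ := by ring
  have h4 : (⌈2 * ((Nat.log 2 T : ℝ) + 1) / c * (β + γ * ℓ) + ℓ⌉₊ : ℝ) <
      2 * ((Nat.log 2 T : ℝ) + 1) / c * (β + γ * ℓ) + ℓ + 1 :=
    Nat.ceil_lt_add_one (by positivity)
  linarith

/-! ### Choice of constants and assembly. -/

theorem theorem4 :
    ∃ k : ℕ, ∀ (P α : ℝ) (γ : ℕ), 0 < P → 0 < α → α < 1 → ∃ K : ℝ, 0 < K ∧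
      ∀ (d T TE : ℕ) (a B C δ R : ℝ) (M : Market d) (x : ℕ → EuclideanSpace ℝ (Fin d))
        (A : ExploreOrCommit (EuclideanSpace ℝ (Fin d)))
        (fallback : A.State → EuclideanSpace ℝ (Fin d) → A.Seed → ℝ),
        2 ≤ T → 1 ≤ TE → P = C + a * B →
        ‖M.sellerParam‖ ≤ a → ‖M.buyerParam‖ ≤ a → (∀ t, ‖x t‖ ≤ B) →
        (∀ᵐ ξ ∂M.noise, |ξ.1| ≤ C ∧ |ξ.2| ≤ C) →
        M.Active x α T →
        A.Guarantee M P B T TE R δ →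
        (∀ ω, 0 ≤ (A.oneBit P (targetBudget P α T TE) T fallback).totalProfit
            M oneBitFeedback x T ω) ∧
        1 - δ - 1 / (T : ℝ) ^ γ ≤
          ((A.oneBit P (targetBudget P α T TE) T fallback).pathLaw M).real
            {ω | (A.oneBit P (targetBudget P α T TE) T fallback).regret
                M oneBitFeedback P x T ω ≤ K * TE * Real.log T ^ k + R} := by
  -- The exponent is 3 from the budget plus 1 from the `log₂ T + 1` grid steps.
  refine ⟨4, fun P α γ hP hα _ => ?_⟩
  obtain ⟨i, hi⟩ := exists_pow_lt_of_lt_one hα (show (2 : ℝ)⁻¹ < 1 by norm_num)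
  set h : ℝ := (2 : ℝ)⁻¹ ^ i with hh
  have h0 : 0 < h := by positivity
  set c : ℝ := h * (α - h) / (2 * P) with hcdef
  have hc : 0 < c := div_pos (mul_pos h0 (by linarith)) (by linarith)
  set Q : ℝ := 8 / c * (2048 * P ^ 4 * (α ^ 2)⁻¹ + 16 * P + 4 * γ) + 24 with hQdef
  have hQ : 0 < Q := by positivity
  -- `Q` pays for the `N` collection rounds, 16 for the `TE` explorations, and `16 * 2 ^ i` for
  -- horizons `T < 2 ^ i`, whose grid need not contain the step `h`.
  refine ⟨4 * P * (Q + 16 + 16 * 2 ^ i), by positivity, ?_⟩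
  intro d T TE a B C δ R M x A fallback hT hTE hPC hs hb hxB hξ hact hA
  refine ⟨fun ω => ExploreOrCommit.oneBit_totalProfit_nonneg T, ?_⟩
  have hx : ∀ t, M.BoundedAt P (x t) := fun t =>
    hPC ▸ Market.boundedAt_of_norm_le hs hb (hxB t) hξ
  have hN' := ceil_collect_rounds_le γ hP hα hc hT hTE
  rw [← hQdef] at hN'
  -- The first summand makes half the expected profit at least `β + γ log T`, so the Chernoff
  -- exponent is at most `-γ log T`; the second ensures `N ≥ log T`, where activity applies.
  set N := ⌈2 * ((Nat.log 2 T : ℝ) + 1) / c * (targetBudget P α T TE + γ * Real.log T) +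
    Real.log T⌉₊ with hNdef
  have hNle : 2 * ((Nat.log 2 T : ℝ) + 1) / c * (targetBudget P α T TE + γ * Real.log T) +
    Real.log T ≤ N := Nat.le_ceil _
  have hℓ := half_le_log_natCast hT
  have hβ0 := targetBudget_pos hP hα hT TE
  have hTE' : (1 : ℝ) ≤ TE := by exact_mod_cast hTE
  set Z : ℝ := TE * Real.log T ^ 4 with hZ
  have hZ1 : (TE : ℝ) ≤ 16 * Z := by
    have e2 : 1 ≤ 4 * Real.log T ^ 2 := by nlinarith
    have : 1 ≤ 16 * Real.log T ^ 4 := by nlinarith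
    nlinarith
  have hK : 4 * P * (Q + 16 + 16 * 2 ^ i) * TE * Real.log T ^ 4 =
      4 * P * (Q * Z + 16 * Z + 2 ^ i * (16 * Z)) := by rw [hZ]; ring
  have hZ0 : 0 ≤ Z := by positivity
  rw [hK]
  have hlog : 0 ≤ 2 * ((Nat.log 2 T : ℝ) + 1) / c *
      (targetBudget P α T TE + γ * Real.log T) := by positivity
  rcases lt_or_ge T N with hTN | hNT
  · refine hA.le_measureReal_oneBit_regret_le_of_short hP hxB hx (by positivity) ?_
    have : (T : ℝ) ≤ N := by exact_mod_cast hTN.le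
    have : (0 : ℝ) ≤ 2 ^ i * (16 * Z) := by positivity
    gcongr
    linarith
  rcases lt_or_ge T (2 ^ i) with hTi | hTi
  · refine hA.le_measureReal_oneBit_regret_le_of_short hP hxB hx (by positivity) ?_
    have h1 : (T : ℝ) ≤ 2 ^ i := by exact_mod_cast hTi.le
    have h2 : (2 : ℝ) ^ i * 1 ≤ 2 ^ i * (16 * Z) := by gcongr; linarith
    have : 0 ≤ Q * Z := by positivity
    gcongr
    linarith
  have hiL : i ≤ Nat.log 2 T := Nat.le_log_of_pow_le (by norm_num) hTi
  refine (hA.le_measureReal_oneBit_regret_le (fallback := fallback) hP hxB hx hact hβ0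
    (le_max_right _ _) hiL (by linarith) hNT (ε := 1 / (T : ℝ) ^ γ) ?_).trans ?_
  · have hT0 : (0 : ℝ) < T := by positivity
    have hexp : 1 / (T : ℝ) ^ γ = Real.exp (-(γ * Real.log T)) := by
      rw [Real.exp_neg, Real.exp_nat_mul, Real.exp_log hT0, one_div]
    rw [hexp, Real.exp_le_exp, ← hh]
    have hL : (0 : ℝ) < (Nat.log 2 T : ℝ) + 1 := by positivity
    have h1 : 2 * ((Nat.log 2 T : ℝ) + 1) / c *
        (targetBudget P α T TE + γ * Real.log T) ≤ N := by linarith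
    have h2 : h * (α - h) / (2 * P * ((Nat.log 2 T : ℝ) + 1)) = c / ((Nat.log 2 T : ℝ) + 1) := by
      rw [hcdef]; field_simp
    have h3 := mul_le_mul_of_nonneg_right h1 (div_pos hc hL).le
    have h4 : 2 * ((Nat.log 2 T : ℝ) + 1) / c * (targetBudget P α T TE + γ * Real.log T) *
        (c / ((Nat.log 2 T : ℝ) + 1)) = 2 * (targetBudget P α T TE + γ * Real.log T) := by
      field_simp
    rw [h2]
    linarith
  · have : IsProbabilityMeasure
        ((A.oneBit P (targetBudget P α T TE) T fallback).pathLaw M) := by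
      unfold Learner.pathLaw; infer_instance
    refine measureReal_mono (Set.ofPred_subset_ofPred.2 fun ω hω => hω.trans ?_)
    have h1 : (0 : ℝ) ≤ 2 ^ i * (16 * Z) := by positivity
    have h2 : (N : ℝ) + TE ≤ Q * Z + 16 * Z + 2 ^ i * (16 * Z) := by linarith
    gcongr
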